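/- **Setting.** Let $\Delta\subset\mathbb R$ be an interval with largest element $1$ (its left end may or may not belong to $\Delta$), let $\mu$ be a positive Borel measure on $\mathbb R$ with $\mu(\mathbb R\setminus\Delta)=0$, and let $w_1,w_2$ be real functions, $w_1\ge 0$ on $\Delta$, such that all moments $\int x^k w_a(x)\,d\mu(x)$ ($k\ge 0$, $a=1,2$) converge absolutely. Assume that $(w_1\,d\mu,w_2\,d\mu)$ is an AT-system on $\Delta$: $w_1,w_2$ are continuous on $\Delta$, and for all $n_1,n_2\ge 0$ and all real polynomials $A_1,A_2$, not both zero, with $\deg A_1<n_1$ and $\deg A_2<n_2$, the function $A_1w_1+A_2w_2$ has at most $n_1+n_2-1$ zeros on $\Delta$. Put $\chi=(1,x,x^2,\dots)^\top$ and $\xi=(w_1,w_2,xw_1,xw_2,x^2w_1,x^2w_2,\dots)^\top$, and suppose that the moment matrix $g=\int_\Delta\chi\,\xi^\top d\mu$ has a Gauss–Borel factorization $g=S^{-1}D\tilde S^{-\top}$, where $S,\tilde S$ are semi-infinite lower unitriangular matrices and $D$ is an invertible diagonal matrix. Let $(B_n)_{n\ge0}=S\chi$ (type II polynomials), $(Q_n)_{n\ge0}=D^{-1}\tilde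 S\,\xi$ (type I linear forms), and let $H=S\Lambda S^{-1}$, where $\Lambda$ has ones on the first superdiagonal and zeros elsewhere. Suppose that the Hessenberg matrix $H$ has nonnegative entries and that $H_{n+2,n}>0$ for all $n\ge0$. Define the dual matrices, for $n,m\ge 0$, $$\hat H_{nm}=\frac{B_m(1)}{B_n(1)}\,H_{nm},\qquad \check H_{nm}=\frac{Q_m(1)}{Q_n(1)}\,H_{mn}.$$ A Markov chain on $\{0,1,2,\dots\}$ is called recurrent (transient) if, for every state $i$, the probability that the chain started at $i$ returns to $i$ is equal to $1$ (less than $1$). It is irreducible if its transition matrix is irreducible. **Theorem.** $\hat H$ and $\check H$ are stochastic matrices. Suppose that both dual Markov chains, with transition matrices $\hat H$ and $\check H$, are irreducible. Then each of them is recurrent if and only if the integral $$\int_\Delta\frac{w_1(x)}{1-x}\,d\mu(x)$$ diverges (i.e. equals $+\infty$, the integrand being understood as $+\infty$ at $x=1$). Both are transient whenever this integral converges. -/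

import Mathlib

namespace MOP

open MeasureTheory
open scoped ENNReal

noncomputable section

/-! ### Multiple orthogonality on the step-line, two weights -/

/-- Algebraic Chebyshev (AT) system: continuous functions `w₁, w₂` on `Δ` such that every nontrivial
combination `A₁ w₁ + A₂ w₂` with `deg A₁ < n₁`, `deg A₂ < n₂` has at most `n₁ + n₂ - 1`
zeros on `Δ`. -/
structure IsATSystem (w₁ w₂ : ℝ → ℝ) (Δ : Set ℝ) : Prop where
  continuousOn_left : ContinuousOn w₁ Δ
  continuousOn_right : ContinuousOn w₂ Δ
  encard_zeros_lt : ∀ n₁ n₂ : ℕ, ∀ A₁ A₂ : Polynomial ℝ,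
    A₁.degree < n₁ → A₂.degree < n₂ → ¬ (A₁ = 0 ∧ A₂ = 0) →
      {x ∈ Δ | A₁.eval x * w₁ x + A₂.eval x * w₂ x = 0}.encard < ((n₁ + n₂ : ℕ) : ℕ∞)

/-- The vector `ξ = (w₁, w₂, x w₁, x w₂, x² w₁, x² w₂, …)`. -/
def xi (w₁ w₂ : ℝ → ℝ) (k : ℕ) (x : ℝ) : ℝ :=
  x ^ (k / 2) * (if Even k then w₁ x else w₂ x)

/-- The moment matrix `g = ∫ χ ξᵀ dμ` with `χ = (1, x, x², …)ᵀ`. -/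
def momentMatrix (μ : Measure ℝ) (w₁ w₂ : ℝ → ℝ) : Matrix ℕ ℕ ℝ :=
  fun i j => ∫ x, x ^ i * xi w₁ w₂ j x ∂μ

/-- Lower unitriangular semi-infinite matrices. -/
def IsLowerUnitriangular (S : Matrix ℕ ℕ ℝ) : Prop :=
  (∀ n, S n n = 1) ∧ ∀ n m, n < m → S n m = 0

/-- The inverse of a lower unitriangular semi-infinite matrix, by forward substitution. -/
def lowerInv (S : Matrix ℕ ℕ ℝ) : ℕ → ℕ → ℝ
  | n, m => (if n = m then 1 else 0) - ∑ k : Fin n, S n k * lowerInv S k m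
termination_by n => n
decreasing_by exact k.2

/-- Gauss–Borel factorization `g = S⁻¹ D S̃⁻ᵀ` with `S`, `S̃` lower unitriangular and `D` an
invertible diagonal matrix (the sum over `k ≤ i` is the whole sum, as `S⁻¹` is lower triangular). -/
structure IsGaussBorel (g S : Matrix ℕ ℕ ℝ) (D : ℕ → ℝ) (St : Matrix ℕ ℕ ℝ) : Prop where
  lower_left : IsLowerUnitriangular S
  lower_right : IsLowerUnitriangular St
  diag_ne_zero : ∀ n, D n ≠ 0
  factorization : ∀ i j,
    g i j = ∑ k ∈ Finset.range (i + 1), lowerInv S i k * D k * lowerInv St j k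

/-- The type II polynomials, `B = S χ`. -/
def typeII (S : Matrix ℕ ℕ ℝ) (n : ℕ) (x : ℝ) : ℝ :=
  ∑ k ∈ Finset.range (n + 1), S n k * x ^ k

/-- The type I linear forms, `Q = D⁻¹ S̃ ξ`. -/
def typeI (w₁ w₂ : ℝ → ℝ) (D : ℕ → ℝ) (St : Matrix ℕ ℕ ℝ) (n : ℕ) (x : ℝ) : ℝ :=
  (D n)⁻¹ * ∑ k ∈ Finset.range (n + 1), St n k * xi w₁ w₂ k x

/-- The Hessenberg matrix `H = S Λ S⁻¹`, `Λ` being the shift with ones on the first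
superdiagonal. -/
def hessenberg (S : Matrix ℕ ℕ ℝ) : Matrix ℕ ℕ ℝ :=
  fun n m => ∑ k ∈ Finset.range (n + 1), S n k * lowerInv S (k + 1) m

/-- `Ĥ = σ⁻¹ H σ`, `σ = diag (B₀(1), B₁(1), …)`. -/
def hatH (S : Matrix ℕ ℕ ℝ) : Matrix ℕ ℕ ℝ :=
  fun n m => (typeII S n 1)⁻¹ * hessenberg S n m * typeII S m 1

/-- `Ȟ = σ⁻¹ Hᵀ σ`, `σ = diag (Q₀(1), Q₁(1), …)`. -/
def checkH (w₁ w₂ : ℝ → ℝ) (S : Matrix ℕ ℕ ℝ) (D : ℕ → ℝ) (St : Matrix ℕ ℕ ℝ) :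
    Matrix ℕ ℕ ℝ :=
  fun n m => (typeI w₁ w₂ D St n 1)⁻¹ * hessenberg S m n * typeI w₁ w₂ D St m 1

/-! ### Markov chains on `ℕ` given by a transition matrix -/

/-- Stochastic matrices: nonnegative entries, row sums one. -/
def IsStochastic (P : Matrix ℕ ℕ ℝ) : Prop :=
  (∀ n m, 0 ≤ P n m) ∧ ∀ n, HasSum (P n) 1

/-- `firstPassage P i r j` is the probability that the chain with transition matrix `P`, started
at `j`, visits `i` at time `r + 1` and at none of the times `1, …, r`. -/
def firstPassage (P : Matrix ℕ ℕ ℝ) (i : ℕ) : ℕ → ℕ → ℝ≥0∞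
  | 0, j => ENNReal.ofReal (P j i)
  | r + 1, j => ∑' k, if k = i then 0 else ENNReal.ofReal (P j k) * firstPassage P i r k

/-- The probability that the chain started at `i` ever returns to `i`. -/
def returnProb (P : Matrix ℕ ℕ ℝ) (i : ℕ) : ℝ≥0∞ :=
  ∑' r, firstPassage P i r i

/-- The chain is recurrent: from every state it returns with probability one. -/
def IsRecurrent (P : Matrix ℕ ℕ ℝ) : Prop := ∀ i, returnProb P i = 1

/-- The chain is transient: for every state the probability of return is less than one. -/
def IsTransient (P : Matrix ℕ ℕ ℝ) : Prop := ∀ i, returnProb P i < 1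

end

end MOP

/-! Everything is read off at state 0. The relations `x B = H B` (`mul_typeII`) and `x Q = Hᵀ Q`
(`mul_typeI_and_hessenberg_eq_zero`), with biorthogonality of `B` and `Q`, show that the powers of
`H` have entries `∫ xⁿ B_j Q_i dμ` (`mixedMoment`). Evaluated at `x = 1`, the same relations make
both dual matrices have row sums one. Their powers are diagonal conjugates of those of `H` and of
its transpose, so both chains have the same `n`-step return probability at 0, namely `∫ xⁿ w₁ / D₀
dμ`.

An irreducible chain is recurrent iff these probabilities have infinite sum (`isRecurrent_iff`), and
summing the geometric series gives `∫ w₁ / (1 - x) dμ` up to a constant. To justify this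
(`tsum_moments_eq_top_iff`), the bound 1 on the moments forces `|x| ≤ 1` almost everywhere, and
grouping the powers in pairs makes the terms nonnegative.

The conjugations need `B_n(1) > 0` and `Q_n(1) > 0` (`typeII_one_pos`, `typeI_one_pos`). Both follow
from counting sign changes: orthogonality forces at least `n` of them inside `Δ`, while the AT
property, or the degree, allows no further zeros. -/

namespace MOP

open MeasureTheory
open scoped ENNReal

noncomputable section

/-! ### Recurrence and transience in terms of the Green function -/

/-- `stepProb P i n j` is the probability that the chain with transition matrix `P`, started at `j`,
is at `i` at time `n`. -/
def stepProb (P : Matrix ℕ ℕ ℝ) (i : ℕ) : ℕ → ℕ → ℝ≥0∞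
  | 0, j => if j = i then 1 else 0
  | n + 1, j => ∑' k, ENNReal.ofReal (P j k) * stepProb P i n k

theorem IsStochastic.tsum_ofReal {P : Matrix ℕ ℕ ℝ} (hP : IsStochastic P) (j : ℕ) :
    ∑' k, ENNReal.ofReal (P j k) = 1 := by
  rw [← ENNReal.ofReal_tsum_of_nonneg (hP.1 j) (hP.2 j).summable, (hP.2 j).tsum_eq,
    ENNReal.ofReal_one]

theorem stepProb_le_one {P : Matrix ℕ ℕ ℝ} (hP : IsStochastic P) (i n j : ℕ) :
    stepProb P i n j ≤ 1 := by
  induction n generalizing j with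
  | zero => unfold stepProb; split_ifs <;> simp
  | succ n ih =>
    unfold stepProb
    calc _ ≤ ∑' k, ENNReal.ofReal (P j k) :=
          ENNReal.tsum_le_tsum fun k => mul_le_of_le_one_right' (ih k)
      _ = 1 := hP.tsum_ofReal j

/-- Decomposition by the time `r + 1` of the first visit to `i`; the induction conditions on the
first step. -/
theorem stepProb_succ_eq_sum (P : Matrix ℕ ℕ ℝ) (i n j : ℕ) :
    stepProb P i (n + 1) j =
      ∑ r ∈ Finset.range (n + 1), firstPassage P i r j * stepProb P i (n - r) i := by
  induction n generalizing j with
  | zero =>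
    simp only [stepProb, zero_add, Finset.range_one, Finset.sum_singleton, firstPassage]
    rw [tsum_eq_single i (by intro k hk; simp [hk]), if_pos rfl, Nat.sub_zero, stepProb, if_pos rfl]
  | succ n ih =>
    rw [stepProb, ENNReal.tsum_eq_add_tsum_ite i, Finset.sum_range_succ', add_comm]
    congr 1
    have h : ∀ k, (if k = i then 0 else ENNReal.ofReal (P j k) * stepProb P i (n + 1) k) =
        ∑ r ∈ Finset.range (n + 1),
          (if k = i then 0 else ENNReal.ofReal (P j k) * firstPassage P i r k) *
            stepProb P i (n - r) i := by
      intro k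
      split_ifs
      · simp
      · rw [ih, Finset.mul_sum]
        simp only [mul_assoc]
    refine Eq.trans ?_ ((tsum_congr (L := .unconditional ℕ) h).trans ?_)
    · congr!
    rw [Summable.tsum_finsetSum fun _ _ => ENNReal.summable]
    refine Finset.sum_congr rfl fun r _ => ?_
    rw [ENNReal.tsum_mul_right, firstPassage, Nat.add_sub_add_right]

theorem sum_firstPassage_le_one {P : Matrix ℕ ℕ ℝ} (hP : IsStochastic P) (i R j : ℕ) :
    ∑ r ∈ Finset.range R, firstPassage P i r j ≤ 1 := by
  induction R generalizing j with
  | zero => simp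
  | succ R ih =>
    rw [Finset.sum_range_succ', add_comm, ← hP.tsum_ofReal j, ENNReal.tsum_eq_add_tsum_ite i]
    simp only [firstPassage]
    gcongr
    rw [← Summable.tsum_finsetSum fun _ _ => ENNReal.summable]
    refine ENNReal.tsum_le_tsum fun k => ?_
    split_ifs
    · simp
    · rw [← Finset.mul_sum]
      exact mul_le_of_le_one_right' (ih k)

theorem returnProb_le_one {P : Matrix ℕ ℕ ℝ} (hP : IsStochastic P) (i : ℕ) :
    returnProb P i ≤ 1 := by
  rw [returnProb, ENNReal.tsum_eq_iSup_nat]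
  exact iSup_le fun R => sum_firstPassage_le_one hP i R i

/-- Truncated renewal inequality. Its sums are finite for a stochastic `P`, so it can be solved for
the Green function; the equation `G = 1 + F G` alone does not exclude `G = ⊤` when `0 < F < 1`. -/
theorem sum_stepProb_le {P : Matrix ℕ ℕ ℝ} (i N : ℕ) :
    ∑ n ∈ Finset.range N, stepProb P i n i ≤
      1 + returnProb P i * ∑ n ∈ Finset.range N, stepProb P i n i := by
  cases N with
  | zero => simp
  | succ N =>
    conv_lhs => rw [Finset.sum_range_succ', add_comm]
    refine add_le_add (by simp [stepProb]) ?_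
    simp_rw [stepProb_succ_eq_sum _ _ _ i]
    rw [Finset.sum_range_diag_flip N fun r m => firstPassage P i r i * stepProb P i m i]
    calc _ ≤ ∑ r ∈ Finset.range N, firstPassage P i r i *
              ∑ n ∈ Finset.range (N + 1), stepProb P i n i := by
            refine Finset.sum_le_sum fun r _ => ?_
            rw [← Finset.mul_sum]
            gcongr
            omega
        _ ≤ _ := by
            rw [← Finset.sum_mul]
            gcongr
            exact ENNReal.sum_le_tsum _

theorem tsum_stepProb_eq (P : Matrix ℕ ℕ ℝ) (i : ℕ) :
    ∑' n, stepProb P i n i = 1 + returnProb P i * ∑' n, stepProb P i n i := by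
  have h0 : stepProb P i 0 i = 1 := by simp [stepProb]
  conv_lhs => rw [tsum_eq_zero_add' ENNReal.summable, h0]
  congr 1
  simp_rw [stepProb_succ_eq_sum,
    ← Finset.Nat.sum_antidiagonal_eq_sum_range_succ
      fun r m => firstPassage P i r i * stepProb P i m i]
  rw [returnProb, ← ENNReal.tsum_mul_right]
  simp_rw [← ENNReal.tsum_mul_left]
  rw [← ENNReal.tsum_prod (f := fun r m => firstPassage P i r i * stepProb P i m i),
    ← Finset.HasAntidiagonal.sigmaAntidiagonalEquivProd.tsum_eq, ENNReal.tsum_sigma']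
  refine tsum_congr fun n => ?_
  rw [tsum_fintype, ← Finset.sum_coe_sort]
  rfl

/-- With return probability `F` and Green function `G`: if `F = 1`, then `G = 1 + G` leaves only `G
= ⊤`; if `F < 1`, the truncated inequality gives `G ≤ 1 / (1 - F)`. -/
theorem returnProb_eq_one_iff {P : Matrix ℕ ℕ ℝ} (hP : IsStochastic P) (i : ℕ) :
    returnProb P i = 1 ↔ ∑' n, stepProb P i n i = ⊤ := by
  constructor
  · intro h
    by_contra hG
    have h1 := tsum_stepProb_eq P i
    rw [h, one_mul] at h1
    have h2 : (0 : ℝ≥0∞) + ∑' n, stepProb P i n i = 1 + ∑' n, stepProb P i n i := by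
      rw [zero_add]; exact h1
    exact zero_ne_one ((ENNReal.add_left_inj hG).1 h2)
  · intro hG
    by_contra h
    have hf : returnProb P i < 1 := lt_of_le_of_ne (returnProb_le_one hP i) h
    have hb : ∀ N, ∑ n ∈ Finset.range N, stepProb P i n i ≤ (1 - returnProb P i)⁻¹ := by
      intro N
      have hfin : ∑ n ∈ Finset.range N, stepProb P i n i ≠ ⊤ :=
        ENNReal.sum_ne_top.2 fun n _ => ((stepProb_le_one hP i n i).trans_lt ENNReal.one_lt_top).ne
      rw [ENNReal.le_inv_iff_mul_le, ENNReal.mul_sub fun _ _ => hfin, mul_one, mul_comm]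
      exact tsub_le_iff_right.2 (sum_stepProb_le i N)
    have : ∑' n, stepProb P i n i ≤ (1 - returnProb P i)⁻¹ := by
      rw [ENNReal.tsum_eq_iSup_nat]
      exact iSup_le hb
    rw [hG, top_le_iff, ENNReal.inv_eq_top] at this
    exact (tsub_pos_of_lt hf).ne' this

/-- The half of Chapman–Kolmogorov that keeps only the paths through `k` at time `a`. -/
theorem mul_stepProb_le (P : Matrix ℕ ℕ ℝ) (i k a n j : ℕ) :
    stepProb P k a j * stepProb P i n k ≤ stepProb P i (a + n) j := by
  induction a generalizing j with
  | zero =>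
    simp only [stepProb, zero_add]
    split_ifs with h
    · simp [h]
    · simp
  | succ a ih =>
    rw [show a + 1 + n = a + n + 1 by omega, stepProb, stepProb, ← ENNReal.tsum_mul_right]
    refine ENNReal.tsum_le_tsum fun l => ?_
    rw [mul_assoc]
    gcongr
    exact ih l

theorem exists_stepProb_pos {P : Matrix ℕ ℕ ℝ} (hP : P.IsIrreducible) (i j : ℕ) :
    ∃ n, 0 < stepProb P j n i := by
  let _ : Quiver ℕ := P.toQuiver
  obtain ⟨p, -⟩ := hP.connected i j
  have key : ∀ j, Quiver.Path i j → ∃ n, 0 < stepProb P j n i := by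
    intro j p
    induction p with
    | nil => exact ⟨0, by simp [stepProb]⟩
    | @cons b c _ e ih =>
      obtain ⟨n, hn⟩ := ih
      refine ⟨n + 1, lt_of_lt_of_le (ENNReal.mul_pos hn.ne' ?_) (mul_stepProb_le P c b n 1 i)⟩
      have h1 : ENNReal.ofReal (P b c) ≤ stepProb P c 1 b := by
        rw [stepProb]
        refine le_trans ?_ (ENNReal.le_tsum c)
        simp [stepProb]
      exact (lt_of_lt_of_le (ENNReal.ofReal_pos.2 e.down) h1).ne'
  exact key j p

/-- Fixed excursions `j → i` and `i → j` of positive probability turn every loop at `i` into a loop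
at `j`. -/
theorem tsum_stepProb_eq_top {P : Matrix ℕ ℕ ℝ} (hP : P.IsIrreducible) {i : ℕ} (j : ℕ)
    (h : ∑' n, stepProb P i n i = ⊤) : ∑' n, stepProb P j n j = ⊤ := by
  obtain ⟨a, ha⟩ := exists_stepProb_pos hP j i
  obtain ⟨b, hb⟩ := exists_stepProb_pos hP i j
  have h1 : stepProb P i a j * (∑' n, stepProb P i n i) * stepProb P j b i ≤
      ∑' n, stepProb P j (a + n + b) j := by
    rw [← ENNReal.tsum_mul_left, ← ENNReal.tsum_mul_right]
    refine ENNReal.tsum_le_tsum fun n => ?_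
    calc _ ≤ stepProb P i (a + n) j * stepProb P j b i := by
          gcongr
          exact mul_stepProb_le P i i a n j
      _ ≤ _ := mul_stepProb_le P j i (a + n) b j
  rw [h, ENNReal.mul_top ha.ne', ENNReal.top_mul hb.ne', top_le_iff] at h1
  rw [← top_le_iff, ← h1]
  exact ENNReal.tsum_comp_le_tsum_of_injective
    (f := fun n => a + n + b) (fun m n hmn => by simpa using hmn) fun n => stepProb P j n j

theorem isRecurrent_iff {P : Matrix ℕ ℕ ℝ} (hP : IsStochastic P) (hI : P.IsIrreducible) (i : ℕ) :
    IsRecurrent P ↔ ∑' n, stepProb P i n i = ⊤ :=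
  ⟨fun h => (returnProb_eq_one_iff hP i).1 (h i),
    fun h j => (returnProb_eq_one_iff hP j).2 (tsum_stepProb_eq_top hI j h)⟩

theorem isTransient_of_ne_top {P : Matrix ℕ ℕ ℝ} (hP : IsStochastic P) (hI : P.IsIrreducible)
    (i : ℕ) (h : ∑' n, stepProb P i n i ≠ ⊤) : IsTransient P := fun j =>
  lt_of_le_of_ne (returnProb_le_one hP j) fun hj =>
    h (tsum_stepProb_eq_top hI i ((returnProb_eq_one_iff hP j).1 hj))

/-! ### Forward substitution -/

theorem lowerInv_eq (S : Matrix ℕ ℕ ℝ) (n m : ℕ) :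
    lowerInv S n m =
      (if n = m then 1 else 0) - ∑ k ∈ Finset.range n, S n k * lowerInv S k m := by
  rw [lowerInv, Finset.sum_range]

theorem lowerInv_eq_zero (S : Matrix ℕ ℕ ℝ) {n m : ℕ} (h : n < m) : lowerInv S n m = 0 := by
  induction n using Nat.strong_induction_on with
  | _ n ih =>
    rw [lowerInv_eq, if_neg h.ne, Finset.sum_eq_zero, sub_zero]
    intro k hk
    rw [ih k (Finset.mem_range.1 hk) ((Finset.mem_range.1 hk).trans h), mul_zero]

theorem lowerInv_self (S : Matrix ℕ ℕ ℝ) (n : ℕ) : lowerInv S n n = 1 := by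
  rw [lowerInv_eq, if_pos rfl, Finset.sum_eq_zero, sub_zero]
  intro k hk
  rw [lowerInv_eq_zero S (Finset.mem_range.1 hk), mul_zero]

theorem sum_mul_lowerInv {S : Matrix ℕ ℕ ℝ} (hS : IsLowerUnitriangular S) (n m : ℕ) :
    ∑ k ∈ Finset.range (n + 1), S n k * lowerInv S k m = if n = m then 1 else 0 := by
  rw [Finset.sum_range_succ, hS.1, one_mul, lowerInv_eq S n m]
  ring

/-- `lowerInv S` is also a left inverse. The recursion over its rows proves this directly, for any
truncation `N` beyond `n`. -/
theorem sum_lowerInv_mul {S : Matrix ℕ ℕ ℝ} (hS : IsLowerUnitriangular S) {y Y : ℕ → ℝ}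
    (hY : ∀ n, Y n = ∑ k ∈ Finset.range (n + 1), S n k * y k) {n N : ℕ} (hn : n < N) :
    ∑ m ∈ Finset.range N, lowerInv S n m * Y m = y n := by
  induction n using Nat.strong_induction_on with
  | _ n ih =>
    have h1 : ∑ m ∈ Finset.range N, lowerInv S n m * Y m =
        Y n - ∑ k ∈ Finset.range n, S n k * ∑ m ∈ Finset.range N, lowerInv S k m * Y m := by
      simp_rw [lowerInv_eq S n, sub_mul, Finset.sum_sub_distrib, Finset.sum_mul, Finset.mul_sum]
      rw [Finset.sum_comm]
      simp [hn, mul_assoc]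
    have h2 : ∑ k ∈ Finset.range n, S n k * ∑ m ∈ Finset.range N, lowerInv S k m * Y m =
        ∑ k ∈ Finset.range n, S n k * y k := Finset.sum_congr rfl fun k hk => by
      rw [ih k (Finset.mem_range.1 hk) ((Finset.mem_range.1 hk).trans hn)]
    rw [h1, h2, hY n, Finset.sum_range_succ, hS.1, one_mul]
    ring

/-! ### Biorthogonality and recurrence relations -/

theorem pow_eq_sum_typeII {S : Matrix ℕ ℕ ℝ} (hS : IsLowerUnitriangular S) {n N : ℕ} (hn : n < N)
    (x : ℝ) : x ^ n = ∑ m ∈ Finset.range N, lowerInv S n m * typeII S m x :=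
  (sum_lowerInv_mul hS (y := fun k => x ^ k) (Y := fun m => typeII S m x) (fun _ => rfl) hn).symm

theorem xi_eq_sum_typeI {w₁ w₂ : ℝ → ℝ} {D : ℕ → ℝ} {St : Matrix ℕ ℕ ℝ}
    (hSt : IsLowerUnitriangular St) (hD : ∀ n, D n ≠ 0) {n N : ℕ} (hn : n < N) (x : ℝ) :
    xi w₁ w₂ n x =
      ∑ m ∈ Finset.range N, lowerInv St n m * (D m * typeI w₁ w₂ D St m x) :=
  (sum_lowerInv_mul hSt (y := fun k => xi w₁ w₂ k x)
    (Y := fun m => D m * typeI w₁ w₂ D St m x)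
    (fun m => by rw [typeI, mul_inv_cancel_left₀ (hD m)]) hn).symm

/-- This shift by two is why `H` has only two subdiagonals. -/
theorem xi_add_two (w₁ w₂ : ℝ → ℝ) (k : ℕ) (x : ℝ) :
    xi w₁ w₂ (k + 2) x = x * xi w₁ w₂ k x := by
  simp only [xi, Nat.even_add_one, not_not, show k + 2 = (k + 1) + 1 from rfl,
    show (k + 1 + 1) / 2 = k / 2 + 1 by omega, pow_succ]
  ring

theorem hessenberg_eq_zero (S : Matrix ℕ ℕ ℝ) {n m : ℕ} (h : n + 1 < m) :
    hessenberg S n m = 0 := by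
  refine Finset.sum_eq_zero fun k hk => ?_
  rw [lowerInv_eq_zero S (by have := Finset.mem_range.1 hk; omega), mul_zero]

/-- `x S χ = S Λ χ = S Λ S⁻¹ B`. -/
theorem mul_typeII {S : Matrix ℕ ℕ ℝ} (hS : IsLowerUnitriangular S) {n N : ℕ} (hN : n + 1 < N)
    (x : ℝ) :
    x * typeII S n x = ∑ m ∈ Finset.range N, hessenberg S n m * typeII S m x := by
  simp_rw [hessenberg, Finset.sum_mul]
  rw [Finset.sum_comm, typeII, Finset.mul_sum]
  refine Finset.sum_congr rfl fun k hk => ?_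
  have hk' := Finset.mem_range.1 hk
  simp_rw [mul_assoc, ← Finset.mul_sum]
  rw [← pow_eq_sum_typeII hS (by omega), pow_succ]
  ring

section Moments

variable {μ : Measure ℝ} {w₁ w₂ : ℝ → ℝ} {S St : Matrix ℕ ℕ ℝ} {D : ℕ → ℝ}

theorem integrable_pow_mul_xi (hmom₁ : ∀ k : ℕ, Integrable (fun x => x ^ k * w₁ x) μ)
    (hmom₂ : ∀ k : ℕ, Integrable (fun x => x ^ k * w₂ x) μ) (i j : ℕ) :
    Integrable (fun x => x ^ i * xi w₁ w₂ j x) μ := by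
  by_cases h : Even j
  · refine (hmom₁ (i + j / 2)).congr (.of_forall fun x => ?_)
    simp only [xi, h, if_true, pow_add]
    ring
  · refine (hmom₂ (i + j / 2)).congr (.of_forall fun x => ?_)
    simp only [xi, h, if_false, pow_add]
    ring

theorem integrable_pow_mul_typeI (hI : ∀ i j, Integrable (fun x => x ^ i * xi w₁ w₂ j x) μ)
    (i m : ℕ) : Integrable (fun x => x ^ i * typeI w₁ w₂ D St m x) μ := by
  have h : Integrable (fun x => ∑ k ∈ Finset.range (m + 1),
      ((D m)⁻¹ * St m k) * (x ^ i * xi w₁ w₂ k x)) μ :=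
    integrable_finsetSum _ fun k _ => (hI i k).const_mul _
  refine h.congr (.of_forall fun x => ?_)
  simp only [typeI, Finset.mul_sum]
  exact Finset.sum_congr rfl fun k _ => by ring

theorem integrable_eval_mul {f : ℝ → ℝ} (hf : ∀ i : ℕ, Integrable (fun x => x ^ i * f x) μ)
    (p : Polynomial ℝ) : Integrable (fun x => p.eval x * f x) μ := by
  simp_rw [Polynomial.eval_eq_sum_range, Finset.sum_mul, mul_assoc]
  exact integrable_finsetSum _ fun k _ => (hf k).const_mul _

/-- The type II polynomial as an element of `ℝ[X]`. -/
def typeIIPoly (S : Matrix ℕ ℕ ℝ) (n : ℕ) : Polynomial ℝ :=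
  ∑ k ∈ Finset.range (n + 1), Polynomial.C (S n k) * Polynomial.X ^ k

theorem eval_typeIIPoly (S : Matrix ℕ ℕ ℝ) (n : ℕ) (x : ℝ) :
    (typeIIPoly S n).eval x = typeII S n x := by
  simp [typeIIPoly, typeII, Polynomial.eval_finsetSum]

theorem integrable_pow_mul_typeII_mul_typeI
    (hI : ∀ i j, Integrable (fun x => x ^ i * xi w₁ w₂ j x) μ) (i n m : ℕ) :
    Integrable (fun x => x ^ i * (typeII S n x * typeI w₁ w₂ D St m x)) μ := by
  refine (integrable_eval_mul (integrable_pow_mul_typeI hI (D := D) (St := St) · m)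
    (Polynomial.X ^ i * typeIIPoly S n)).congr (.of_forall fun x => ?_)
  simp [eval_typeIIPoly, mul_assoc]

/-- This is `S g = D S̃⁻ᵀ`, entry by entry. -/
theorem integral_typeII_mul_xi (hGB : IsGaussBorel (momentMatrix μ w₁ w₂) S D St)
    (hI : ∀ i j, Integrable (fun x => x ^ i * xi w₁ w₂ j x) μ) (n j : ℕ) :
    ∫ x, typeII S n x * xi w₁ w₂ j x ∂μ = D n * lowerInv St j n := by
  have h1 : ∫ x, typeII S n x * xi w₁ w₂ j x ∂μ =
      ∑ i ∈ Finset.range (n + 1), S n i * momentMatrix μ w₁ w₂ i j := by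
    simp_rw [typeII, Finset.sum_mul, mul_assoc]
    rw [integral_finsetSum _ fun i _ => (hI i j).const_mul _]
    simp_rw [integral_const_mul, momentMatrix]
  -- The range of `k` is made independent of `i`, so that the two sums can be exchanged.
  have h2 : ∀ i ∈ Finset.range (n + 1), momentMatrix μ w₁ w₂ i j =
      ∑ k ∈ Finset.range (n + 1), lowerInv S i k * D k * lowerInv St j k := by
    intro i hi
    rw [hGB.factorization]
    refine Finset.sum_subset (Finset.range_mono (by simpa using hi)) fun k _ hk => ?_
    rw [lowerInv_eq_zero S (by simpa using hk), zero_mul, zero_mul]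
  rw [h1, Finset.sum_congr rfl fun i hi => by rw [h2 i hi, Finset.mul_sum], Finset.sum_comm]
  have h3 : ∀ k, ∑ i ∈ Finset.range (n + 1), S n i * (lowerInv S i k * D k * lowerInv St j k) =
      (if n = k then 1 else 0) * (D k * lowerInv St j k) := by
    intro k
    rw [← sum_mul_lowerInv hGB.lower_left n k, Finset.sum_mul]
    exact Finset.sum_congr rfl fun i _ => by ring
  simp [h3]

theorem integral_typeII_mul_typeI (hGB : IsGaussBorel (momentMatrix μ w₁ w₂) S D St)
    (hI : ∀ i j, Integrable (fun x => x ^ i * xi w₁ w₂ j x) μ) (n m : ℕ) :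
    ∫ x, typeII S n x * typeI w₁ w₂ D St m x ∂μ = if n = m then 1 else 0 := by
  have hint : ∀ j, Integrable (fun x => typeII S n x * xi w₁ w₂ j x) μ := fun j =>
    (integrable_eval_mul (hI · j) (typeIIPoly S n)).congr
      (.of_forall fun x => by simp [eval_typeIIPoly])
  have h1 : ∀ x, typeII S n x * typeI w₁ w₂ D St m x = ∑ j ∈ Finset.range (m + 1),
      ((D m)⁻¹ * St m j) * (typeII S n x * xi w₁ w₂ j x) := by
    intro x
    simp only [typeI, Finset.mul_sum]
    exact Finset.sum_congr rfl fun k _ => by ring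
  simp_rw [h1]
  rw [integral_finsetSum _ fun j _ => (hint j).const_mul _]
  simp_rw [integral_const_mul, integral_typeII_mul_xi hGB hI]
  have h2 : ∀ j, (D m)⁻¹ * St m j * (D n * lowerInv St j n) =
      (D m)⁻¹ * D n * (St m j * lowerInv St j n) := fun j => by ring
  simp_rw [h2]
  rw [← Finset.mul_sum, sum_mul_lowerInv hGB.lower_right]
  by_cases h : n = m
  · subst h; simp [hGB.diag_ne_zero n]
  · simp [h, Ne.symm h]

theorem integral_pow_mul_typeI (hGB : IsGaussBorel (momentMatrix μ w₁ w₂) S D St)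
    (hI : ∀ i j, Integrable (fun x => x ^ i * xi w₁ w₂ j x) μ) (k n : ℕ) :
    ∫ x, x ^ k * typeI w₁ w₂ D St n x ∂μ = lowerInv S k n := by
  have h1 : ∀ x, x ^ k * typeI w₁ w₂ D St n x = ∑ m ∈ Finset.range (k + 1),
      lowerInv S k m * (typeII S m x * typeI w₁ w₂ D St n x) := by
    intro x
    rw [pow_eq_sum_typeII hGB.lower_left (Nat.lt_succ_self k), Finset.sum_mul]
    exact Finset.sum_congr rfl fun m _ => by ring
  have hint : ∀ m, Integrable (fun x => typeII S m x * typeI w₁ w₂ D St n x) μ := fun m => by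
    simpa using integrable_pow_mul_typeII_mul_typeI (S := S) (D := D) (St := St) hI 0 m n
  simp_rw [h1]
  rw [integral_finsetSum _ fun j _ => (hint j).const_mul _]
  simp_rw [integral_const_mul, integral_typeII_mul_typeI hGB hI]
  simp only [mul_ite, mul_one, mul_zero, Finset.sum_ite_eq', Finset.mem_range]
  split_ifs with h
  · rfl
  · rw [lowerInv_eq_zero S (by omega)]

/-- The moments of `Q_n` form column `n` of the unitriangular `S⁻¹`: zero below order `n`, and one
at order `n`. -/
theorem integral_eval_mul_typeI (hGB : IsGaussBorel (momentMatrix μ w₁ w₂) S D St)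
    (hI : ∀ i j, Integrable (fun x => x ^ i * xi w₁ w₂ j x) μ) {n : ℕ} {p : Polynomial ℝ}
    (hp : p.natDegree ≤ n) : ∫ x, p.eval x * typeI w₁ w₂ D St n x ∂μ = p.coeff n := by
  simp_rw [Polynomial.eval_eq_sum_range' (Nat.lt_succ_of_le hp), Finset.sum_mul, mul_assoc]
  rw [integral_finsetSum _ fun k _ => (integrable_pow_mul_typeI hI k n).const_mul _]
  simp_rw [integral_const_mul, integral_pow_mul_typeI hGB hI]
  rw [Finset.sum_range_succ, lowerInv_self, mul_one, Finset.sum_eq_zero, zero_add]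
  intro k hk
  rw [lowerInv_eq_zero S (Finset.mem_range.1 hk), mul_zero]

/-- The moments `∫ xⁿ B_j Q_i dμ`, i.e. the entries of the powers of the Hessenberg matrix. -/
def mixedMoment (μ : Measure ℝ) (w₁ w₂ : ℝ → ℝ) (S : Matrix ℕ ℕ ℝ) (D : ℕ → ℝ)
    (St : Matrix ℕ ℕ ℝ) (n j i : ℕ) : ℝ :=
  ∫ x, x ^ n * (typeII S j x * typeI w₁ w₂ D St i x) ∂μ

theorem mixedMoment_zero (hGB : IsGaussBorel (momentMatrix μ w₁ w₂) S D St)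
    (hI : ∀ i j, Integrable (fun x => x ^ i * xi w₁ w₂ j x) μ) (j i : ℕ) :
    mixedMoment μ w₁ w₂ S D St 0 j i = if j = i then 1 else 0 := by
  simp [mixedMoment, integral_typeII_mul_typeI hGB hI]

theorem mixedMoment_succ (hGB : IsGaussBorel (momentMatrix μ w₁ w₂) S D St)
    (hI : ∀ i j, Integrable (fun x => x ^ i * xi w₁ w₂ j x) μ) (n j i : ℕ) :
    mixedMoment μ w₁ w₂ S D St (n + 1) j i =
      ∑ k ∈ Finset.range (j + 2), hessenberg S j k * mixedMoment μ w₁ w₂ S D St n k i := by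
  simp_rw [mixedMoment, ← integral_const_mul]
  rw [← integral_finsetSum _ fun k _ =>
    (integrable_pow_mul_typeII_mul_typeI hI n k i).const_mul _]
  refine integral_congr_ae (.of_forall fun x => ?_)
  have := mul_typeII hGB.lower_left (show j + 1 < j + 2 by omega) x
  calc _ = x ^ n * ((x * typeII S j x) * typeI w₁ w₂ D St i x) := by ring
    _ = _ := by
      rw [this, Finset.sum_mul, Finset.mul_sum]
      exact Finset.sum_congr rfl fun k _ => by ring

theorem exists_mul_typeI_eq_sum (hGB : IsGaussBorel (momentMatrix μ w₁ w₂) S D St) (m : ℕ) :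
    ∃ c : ℕ → ℝ, ∀ x, x * typeI w₁ w₂ D St m x =
      ∑ k ∈ Finset.range (m + 3), c k * typeI w₁ w₂ D St k x := by
  refine ⟨fun k => ∑ j ∈ Finset.range (m + 1),
    (D m)⁻¹ * St m j * (lowerInv St (j + 2) k * D k), fun x => ?_⟩
  simp_rw [Finset.sum_mul]
  rw [Finset.sum_comm]
  conv_lhs => rw [typeI, Finset.mul_sum, Finset.mul_sum]
  refine Finset.sum_congr rfl fun j hj => ?_
  have hj' := Finset.mem_range.1 hj
  calc _ = (D m)⁻¹ * St m j * xi w₁ w₂ (j + 2) x := by rw [xi_add_two]; ring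
    _ = _ := by
      rw [xi_eq_sum_typeI hGB.lower_right hGB.diag_ne_zero (show j + 2 < m + 3 by omega),
        Finset.mul_sum]
      exact Finset.sum_congr rfl fun k _ => by ring

theorem mixedMoment_one (hGB : IsGaussBorel (momentMatrix μ w₁ w₂) S D St)
    (hI : ∀ i j, Integrable (fun x => x ^ i * xi w₁ w₂ j x) μ) (j i : ℕ) :
    mixedMoment μ w₁ w₂ S D St 1 j i = hessenberg S j i := by
  rw [mixedMoment_succ hGB hI]
  simp only [mixedMoment_zero hGB hI, mul_ite, mul_one, mul_zero, Finset.sum_ite_eq',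
    Finset.mem_range]
  split_ifs with h
  · rfl
  · rw [hessenberg_eq_zero S (by omega)]

/-- Some finite expansion of `x Q_m` exists by the shift of `ξ`; integrating it against `B_k`
identifies its coefficients as the column `m` of `H`, which must then vanish beyond row `m + 2`. -/
theorem mul_typeI_and_hessenberg_eq_zero (hGB : IsGaussBorel (momentMatrix μ w₁ w₂) S D St)
    (hI : ∀ i j, Integrable (fun x => x ^ i * xi w₁ w₂ j x) μ) (m : ℕ) :
    (∀ x, x * typeI w₁ w₂ D St m x =
      ∑ k ∈ Finset.range (m + 3), hessenberg S k m * typeI w₁ w₂ D St k x) ∧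
    ∀ k, m + 2 < k → hessenberg S k m = 0 := by
  obtain ⟨c, hc⟩ := exists_mul_typeI_eq_sum hGB m
  have key : ∀ k, hessenberg S k m = if k < m + 3 then c k else 0 := by
    intro k
    rw [← mixedMoment_one hGB hI, mixedMoment]
    have h1 : ∀ x, x ^ 1 * (typeII S k x * typeI w₁ w₂ D St m x) =
        ∑ l ∈ Finset.range (m + 3), c l * (x ^ 0 * (typeII S k x * typeI w₁ w₂ D St l x)) := by
      intro x
      calc _ = typeII S k x * (x * typeI w₁ w₂ D St m x) := by ring
        _ = _ := by
          rw [hc, Finset.mul_sum]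
          exact Finset.sum_congr rfl fun k _ => by ring
    simp_rw [h1]
    rw [integral_finsetSum _ fun l _ =>
      (integrable_pow_mul_typeII_mul_typeI hI 0 k l).const_mul _]
    simp_rw [integral_const_mul]
    have h2 := mixedMoment_zero hGB hI k
    simp_rw [mixedMoment] at h2
    simp_rw [h2]
    simp
  refine ⟨fun x => ?_, fun k hk => ?_⟩
  · rw [hc]
    refine Finset.sum_congr rfl fun k hk => ?_
    rw [key, if_pos (Finset.mem_range.1 hk)]
  · rw [key, if_neg (by omega)]

theorem mixedMoment_succ' (hGB : IsGaussBorel (momentMatrix μ w₁ w₂) S D St)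
    (hI : ∀ i j, Integrable (fun x => x ^ i * xi w₁ w₂ j x) μ) (n j i : ℕ) :
    mixedMoment μ w₁ w₂ S D St (n + 1) j i =
      ∑ k ∈ Finset.range (i + 3), hessenberg S k i * mixedMoment μ w₁ w₂ S D St n j k := by
  simp_rw [mixedMoment, ← integral_const_mul]
  rw [← integral_finsetSum _ fun k _ =>
    (integrable_pow_mul_typeII_mul_typeI hI n j k).const_mul _]
  refine integral_congr_ae (.of_forall fun x => ?_)
  have := (mul_typeI_and_hessenberg_eq_zero hGB hI i).1 x
  calc _ = x ^ n * (typeII S j x * (x * typeI w₁ w₂ D St i x)) := by ring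
    _ = _ := by
      rw [this, Finset.mul_sum, Finset.mul_sum]
      exact Finset.sum_congr rfl fun k _ => by ring

theorem mixedMoment_nonneg (hGB : IsGaussBorel (momentMatrix μ w₁ w₂) S D St)
    (hI : ∀ i j, Integrable (fun x => x ^ i * xi w₁ w₂ j x) μ)
    (hH : ∀ n m, 0 ≤ hessenberg S n m) (n j i : ℕ) :
    0 ≤ mixedMoment μ w₁ w₂ S D St n j i := by
  induction n generalizing j with
  | zero => rw [mixedMoment_zero hGB hI]; split_ifs <;> norm_num
  | succ n ih =>
    rw [mixedMoment_succ hGB hI]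
    exact Finset.sum_nonneg fun k _ => mul_nonneg (hH j k) (ih k)

/-! ### The dual chains -/

/-- At `x = 1` the recurrence says that `B(1)` is a positive eigenvector of `H` with eigenvalue one.
-/
theorem hatH_isStochastic (hS : IsLowerUnitriangular S)
    (hH : ∀ n m, 0 ≤ hessenberg S n m) (hB : ∀ n, 0 < typeII S n 1) :
    IsStochastic (hatH S) := by
  refine ⟨fun n m => mul_nonneg (mul_nonneg (inv_nonneg.2 (hB n).le) (hH n m)) (hB m).le,
    fun n => ?_⟩
  have h1 : ∑ m ∈ Finset.range (n + 2), hatH S n m = 1 := by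
    simp_rw [hatH, mul_assoc, ← Finset.mul_sum]
    rw [← mul_typeII hS (show n + 1 < n + 2 by omega), one_mul, inv_mul_cancel₀ (hB n).ne']
  rw [← h1]
  refine hasSum_sum_of_ne_finset_zero fun m hm => ?_
  rw [hatH, hessenberg_eq_zero S (by have := Finset.mem_range.not.1 hm; omega)]
  ring

theorem checkH_isStochastic (hGB : IsGaussBorel (momentMatrix μ w₁ w₂) S D St)
    (hI : ∀ i j, Integrable (fun x => x ^ i * xi w₁ w₂ j x) μ)
    (hH : ∀ n m, 0 ≤ hessenberg S n m) (hQ : ∀ n, 0 < typeI w₁ w₂ D St n 1) :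
    IsStochastic (checkH w₁ w₂ S D St) := by
  refine ⟨fun n m => mul_nonneg (mul_nonneg (inv_nonneg.2 (hQ n).le) (hH m n)) (hQ m).le,
    fun n => ?_⟩
  obtain ⟨h2, h3⟩ := mul_typeI_and_hessenberg_eq_zero hGB hI n
  have h1 : ∑ m ∈ Finset.range (n + 3), checkH w₁ w₂ S D St n m = 1 := by
    simp_rw [checkH, mul_assoc, ← Finset.mul_sum]
    rw [← h2, one_mul, inv_mul_cancel₀ (hQ n).ne']
  rw [← h1]
  refine hasSum_sum_of_ne_finset_zero fun m hm => ?_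
  rw [checkH, h3 m (by have := Finset.mem_range.not.1 hm; omega)]
  ring

theorem stepProb_hatH (hGB : IsGaussBorel (momentMatrix μ w₁ w₂) S D St)
    (hI : ∀ i j, Integrable (fun x => x ^ i * xi w₁ w₂ j x) μ)
    (hH : ∀ n m, 0 ≤ hessenberg S n m) (hB : ∀ n, 0 < typeII S n 1) (i n j : ℕ) :
    stepProb (hatH S) i n j = ENNReal.ofReal
      ((typeII S j 1)⁻¹ * mixedMoment μ w₁ w₂ S D St n j i * typeII S i 1) := by
  induction n generalizing j with
  | zero =>
    rw [mixedMoment_zero hGB hI, stepProb]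
    split_ifs with h
    · subst h; simp [(hB j).ne']
    · simp
  | succ n ih =>
    have hst := hatH_isStochastic hGB.lower_left hH hB
    rw [stepProb, mixedMoment_succ hGB hI, tsum_eq_sum (s := Finset.range (j + 2))]
    · simp_rw [ih, ← ENNReal.ofReal_mul (hst.1 _ _)]
      rw [← ENNReal.ofReal_sum_of_nonneg]
      · congr 1
        rw [Finset.mul_sum, Finset.sum_mul]
        refine Finset.sum_congr rfl fun k _ => ?_
        rw [hatH]
        have := (hB k).ne'
        field_simp
      · intro k _
        exact mul_nonneg (hst.1 _ _) (mul_nonneg (mul_nonneg (inv_nonneg.2 (hB k).le)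
          (mixedMoment_nonneg hGB hI hH n k i)) (hB i).le)
    · intro k hk
      rw [hatH, hessenberg_eq_zero S (by have := Finset.mem_range.not.1 hk; omega)]
      simp

/-- Transposition exchanges the indices of the mixed moment, so the induction uses the recurrence
for `Q` (`mixedMoment_succ'`). -/
theorem stepProb_checkH (hGB : IsGaussBorel (momentMatrix μ w₁ w₂) S D St)
    (hI : ∀ i j, Integrable (fun x => x ^ i * xi w₁ w₂ j x) μ)
    (hH : ∀ n m, 0 ≤ hessenberg S n m) (hQ : ∀ n, 0 < typeI w₁ w₂ D St n 1) (i n j : ℕ) :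
    stepProb (checkH w₁ w₂ S D St) i n j = ENNReal.ofReal
      ((typeI w₁ w₂ D St j 1)⁻¹ * mixedMoment μ w₁ w₂ S D St n i j *
        typeI w₁ w₂ D St i 1) := by
  induction n generalizing j with
  | zero =>
    rw [mixedMoment_zero hGB hI, stepProb]
    by_cases h : j = i
    · subst h; simp [(hQ j).ne']
    · simp [h, Ne.symm h]
  | succ n ih =>
    have hst := checkH_isStochastic hGB hI hH hQ
    rw [stepProb, mixedMoment_succ' hGB hI, tsum_eq_sum (s := Finset.range (j + 3))]
    · simp_rw [ih, ← ENNReal.ofReal_mul (hst.1 _ _)]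
      rw [← ENNReal.ofReal_sum_of_nonneg]
      · congr 1
        rw [Finset.mul_sum, Finset.sum_mul]
        refine Finset.sum_congr rfl fun k _ => ?_
        rw [checkH]
        have := (hQ k).ne'
        field_simp
      · intro k _
        exact mul_nonneg (hst.1 _ _) (mul_nonneg (mul_nonneg (inv_nonneg.2 (hQ k).le)
          (mixedMoment_nonneg hGB hI hH n i k)) (hQ i).le)
    · intro k hk
      rw [checkH, (mul_typeI_and_hessenberg_eq_zero hGB hI j).2 k
        (by have := Finset.mem_range.not.1 hk; omega)]
      simp

end Moments

/-! ### Sign changes -/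

/-- Points lying strictly between two points of `Δ`. -/
def IsInner (Δ : Set ℝ) (z : ℝ) : Prop := ∃ a ∈ Δ, ∃ b ∈ Δ, a < z ∧ z < b

theorem IsInner.mono {Δ Δ' : Set ℝ} (h : Δ ⊆ Δ') {z : ℝ} (hz : IsInner Δ z) : IsInner Δ' z := by
  obtain ⟨a, ha, b, hb, hab⟩ := hz
  exact ⟨a, h ha, b, h hb, hab⟩

theorem IsInner.mem {Δ : Set ℝ} (hΔ : Δ.OrdConnected) {z : ℝ} (hz : IsInner Δ z) : z ∈ Δ := by
  obtain ⟨a, ha, b, hb, h1, h2⟩ := hz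
  exact hΔ.out ha hb ⟨h1.le, h2.le⟩

theorem exists_zero_of_mul_neg {Δ : Set ℝ} (hΔ : Δ.OrdConnected) {f : ℝ → ℝ}
    (hf : ContinuousOn f Δ) {a b : ℝ} (ha : a ∈ Δ) (hb : b ∈ Δ) (hab : a ≤ b)
    (h : f a * f b < 0) : ∃ z, a < z ∧ z < b ∧ f z = 0 := by
  have hf' : ContinuousOn f (Set.Icc a b) := hf.mono (hΔ.out ha hb)
  rcases mul_neg_iff.1 h with ⟨h1, h2⟩ | ⟨h1, h2⟩
  · obtain ⟨z, hz, hz0⟩ := intermediate_value_Ioo' hab hf' ⟨h2, h1⟩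
    exact ⟨z, hz.1, hz.2, hz0⟩
  · obtain ⟨z, hz, hz0⟩ := intermediate_value_Ioo hab hf' ⟨h1, h2⟩
    exact ⟨z, hz.1, hz.2, hz0⟩

theorem exists_constant_sign {Δ : Set ℝ} (hΔ : Δ.OrdConnected) {f : ℝ → ℝ}
    (hf : ContinuousOn f Δ) (h : ∀ z, IsInner Δ z → f z ≠ 0) :
    ∃ ε : ℝ, (ε = 1 ∨ ε = -1) ∧ ∀ x ∈ Δ, 0 ≤ ε * f x := by
  by_contra! hcon
  obtain ⟨a, ha, ha'⟩ := hcon 1 (.inl rfl)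
  obtain ⟨b, hb, hb'⟩ := hcon (-1) (.inr rfl)
  have hneg : f a * f b < 0 := mul_neg_of_neg_of_pos (by linarith) (by linarith)
  rcases le_total a b with hab | hab
  · obtain ⟨z, h1, h2, h3⟩ := exists_zero_of_mul_neg hΔ hf ha hb hab hneg
    exact h z ⟨a, ha, b, hb, h1, h2⟩ h3
  · obtain ⟨z, h1, h2, h3⟩ := exists_zero_of_mul_neg hΔ hf hb ha hab (by rwa [mul_comm])
    exact h z ⟨b, hb, a, ha, h1, h2⟩ h3

/-- A continuous function with finitely many zeros changes sign exactly at some of them. -/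
theorem exists_sign_separator (Z : Finset ℝ) {Δ : Set ℝ} (hΔ : Δ.OrdConnected) {f : ℝ → ℝ}
    (hf : ContinuousOn f Δ) (h : ∀ z, IsInner Δ z → f z = 0 → z ∈ Z) :
    ∃ Z' ⊆ Z, ∃ ε : ℝ, (ε = 1 ∨ ε = -1) ∧ ∀ x ∈ Δ, 0 ≤ ε * f x * ∏ z ∈ Z', (x - z) := by
  induction Z using Finset.induction_on_max generalizing Δ with
  | empty =>
    obtain ⟨ε, hε, hx⟩ := exists_constant_sign hΔ hf fun z hz h0 => by simpa using h z hz h0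
    exact ⟨∅, subset_rfl, ε, hε, by simpa using hx⟩
  | insert z s hs ih =>
    -- `Δ` is cut at the largest candidate `z`: the induction handles the left piece, and the right
    -- piece has no inner zero.
    obtain ⟨Z', hZ', ε, hε, hl⟩ := ih (Δ := Δ ∩ Set.Iic z) (hΔ.inter Set.ordConnected_Iic)
      (hf.mono Set.inter_subset_left) fun y hy hy0 => by
        have h1 := h y (hy.mono Set.inter_subset_left) hy0
        obtain ⟨-, -, b, hb, -, hyb⟩ := hy
        exact (Finset.mem_insert.1 h1).resolve_left (hyb.trans_le hb.2).ne
    obtain ⟨δ, hδ, hr⟩ := exists_constant_sign (Δ := Δ ∩ Set.Ici z) (hΔ.inter Set.ordConnected_Ici)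
      (hf.mono Set.inter_subset_left) fun y hy hy0 => by
        have h1 := h y (hy.mono Set.inter_subset_left) hy0
        obtain ⟨a, ha, -, -, hay, -⟩ := hy
        have hzy : z < y := lt_of_le_of_lt ha.2 hay
        rcases Finset.mem_insert.1 h1 with h2 | h2
        · exact hzy.ne' h2
        · exact (hs y h2).not_gt hzy
    have hpos : ∀ x, z ≤ x → 0 ≤ ∏ w ∈ Z', (x - w) := fun x hx =>
      Finset.prod_nonneg fun w hw => by linarith [hs w (hZ' hw)]
    -- On the right of `z` the product over `Z'` is nonnegative, so `z` is a sign change to be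
    -- recorded exactly when `ε ≠ δ`.
    by_cases hεδ : ε = δ
    · refine ⟨Z', hZ'.trans (Finset.subset_insert z s), ε, hε, fun x hx => ?_⟩
      rcases le_total x z with hxz | hxz
      · exact hl x ⟨hx, hxz⟩
      · exact mul_nonneg (hεδ ▸ hr x ⟨hx, hxz⟩) (hpos x hxz)
    · have hδε : δ = -ε := by
        rcases hε with rfl | rfl <;> rcases hδ with rfl | rfl <;> simp_all
      have hzZ' : z ∉ Z' := fun hz => lt_irrefl _ (hs z (hZ' hz))
      refine ⟨insert z Z', Finset.insert_subset_insert z hZ', δ, hδ, fun x hx => ?_⟩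
      rw [Finset.prod_insert hzZ']
      rcases le_total x z with hxz | hxz
      · have h1 := mul_nonneg (hl x ⟨hx, hxz⟩) (sub_nonneg.2 hxz)
        rw [hδε]
        linarith
      · exact mul_nonneg (hr x ⟨hx, hxz⟩) (mul_nonneg (sub_nonneg.2 hxz) (hpos x hxz))

/-! ### Chebyshev systems -/

/-- Linear combinations of the first `N` entries of `ξ`. -/
def linForm (w₁ w₂ : ℝ → ℝ) (N : ℕ) (c : ℕ → ℝ) (x : ℝ) : ℝ :=
  ∑ k ∈ Finset.range N, c k * xi w₁ w₂ k x

section AT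

variable {w₁ w₂ : ℝ → ℝ} {Δ : Set ℝ}

theorem continuousOn_linForm (hAT : IsATSystem w₁ w₂ Δ) (N : ℕ) (c : ℕ → ℝ) :
    ContinuousOn (linForm w₁ w₂ N c) Δ := by
  unfold linForm
  refine continuousOn_finsetSum _ fun k _ => continuousOn_const.mul ?_
  unfold xi
  refine (continuous_pow _).continuousOn.mul ?_
  split_ifs
  · exact hAT.continuousOn_left
  · exact hAT.continuousOn_right

theorem degree_sum_C_mul_X_pow_lt (n : ℕ) (a : ℕ → ℝ) :
    (∑ i ∈ Finset.range n, Polynomial.C (a i) * Polynomial.X ^ i : Polynomial ℝ).degree < n := by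
  rw [Polynomial.degree_lt_iff_coeff_zero]
  intro m hm
  simp [Polynomial.finsetSum_coeff, Polynomial.coeff_X_pow, hm]

/-- Even-indexed coefficients form `A₁` and odd-indexed ones `A₂`; the degree bounds `(N + 1) / 2`
and `N / 2` add up to `N`. -/
theorem encard_zeros_linForm_lt (hAT : IsATSystem w₁ w₂ Δ) {N : ℕ} {c : ℕ → ℝ}
    (hc : ∃ j < N, c j ≠ 0) : {x ∈ Δ | linForm w₁ w₂ N c x = 0}.encard < N := by
  set A₁ : Polynomial ℝ := ∑ i ∈ Finset.range ((N + 1) / 2),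
    Polynomial.C (c (2 * i)) * Polynomial.X ^ i with hA₁
  set A₂ : Polynomial ℝ := ∑ i ∈ Finset.range (N / 2),
    Polynomial.C (c (2 * i + 1)) * Polynomial.X ^ i with hA₂
  have hform : ∀ x, A₁.eval x * w₁ x + A₂.eval x * w₂ x = linForm w₁ w₂ N c x := by
    intro x
    have h1 : ∀ M, (∑ i ∈ Finset.range ((M + 1) / 2), c (2 * i) * x ^ i) * w₁ x +
        (∑ i ∈ Finset.range (M / 2), c (2 * i + 1) * x ^ i) * w₂ x = linForm w₁ w₂ M c x := by
      intro M
      induction M with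
      | zero => simp [linForm]
      | succ M ih =>
        rw [linForm, Finset.sum_range_succ, ← linForm, ← ih]
        rcases Nat.even_or_odd' M with ⟨l, rfl | rfl⟩
        · rw [show (2 * l + 1 + 1) / 2 = l + 1 by omega, show (2 * l + 1) / 2 = l by omega,
            show 2 * l / 2 = l by omega, Finset.sum_range_succ]
          simp only [xi, even_two_mul, if_true, show 2 * l / 2 = l by omega]
          ring
        · rw [show (2 * l + 1 + 1 + 1) / 2 = l + 1 by omega,
            show (2 * l + 1 + 1) / 2 = l + 1 by omega, show (2 * l + 1) / 2 = l by omega,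
            Finset.sum_range_succ _ l]
          simp only [xi, Nat.not_even_two_mul_add_one, if_false,
            show (2 * l + 1) / 2 = l by omega]
          rw [Finset.sum_range_succ (fun i => c (2 * i + 1) * x ^ i) l]
          ring
    rw [← h1 N]
    simp [hA₁, hA₂, Polynomial.eval_finsetSum]
  have key := hAT.encard_zeros_lt ((N + 1) / 2) (N / 2) A₁ A₂
    (degree_sum_C_mul_X_pow_lt _ _) (degree_sum_C_mul_X_pow_lt _ _) ?_
  · simpa only [hform, show (N + 1) / 2 + N / 2 = N by omega] using key
  · rintro ⟨h1, h2⟩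
    obtain ⟨j, hj, hcj⟩ := hc
    rcases Nat.even_or_odd' j with ⟨l, rfl | rfl⟩
    · have := congrArg (fun p => p.coeff l) h1
      simp [hA₁, Polynomial.finsetSum_coeff, Polynomial.coeff_X_pow] at this
      exact hcj (this (by omega))
    · have := congrArg (fun p => p.coeff l) h2
      simp [hA₂, Polynomial.finsetSum_coeff, Polynomial.coeff_X_pow] at this
      exact hcj (this (by omega))

theorem card_lt_of_linForm_eq_zero (hAT : IsATSystem w₁ w₂ Δ) {N : ℕ} {c : ℕ → ℝ}
    (hc : ∃ j < N, c j ≠ 0) {T : Finset ℝ} (hT : ∀ z ∈ T, z ∈ Δ ∧ linForm w₁ w₂ N c z = 0) :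
    T.card < N := by
  have h1 : (T : Set ℝ).encard ≤ {x ∈ Δ | linForm w₁ w₂ N c x = 0}.encard :=
    Set.encard_le_encard fun z hz => hT z hz
  rw [Set.encard_coe_eq_coe_finsetCard] at h1
  exact_mod_cast h1.trans_lt (encard_zeros_linForm_lt hAT hc)

/-- There is one more unknown coefficient than there are equations. -/
theorem exists_linForm_eq_zero (w₁ w₂ : ℝ → ℝ) (T : Finset ℝ) :
    ∃ c : ℕ → ℝ, (∃ j < T.card + 1, c j ≠ 0) ∧
      ∀ z ∈ T, linForm w₁ w₂ (T.card + 1) c z = 0 := by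
  let φ : (Fin (T.card + 1) → ℝ) →ₗ[ℝ] (T → ℝ) :=
    { toFun := fun c z => ∑ k, c k * xi w₁ w₂ k z
      map_add' := fun c d => by ext z; simp [add_mul, Finset.sum_add_distrib]
      map_smul' := fun r c => by ext z; simp [Finset.mul_sum, mul_assoc] }
  have hker : LinearMap.ker φ ≠ ⊥ := LinearMap.ker_ne_bot_of_finrank_lt (by simp)
  obtain ⟨c, hc, hc0⟩ := Submodule.exists_mem_ne_zero_of_ne_bot hker
  refine ⟨fun k => if h : k < T.card + 1 then c ⟨k, h⟩ else 0, ?_, fun z hz => ?_⟩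
  · obtain ⟨j, hj⟩ := Function.ne_iff.1 hc0
    exact ⟨j, j.2, by dsimp only; rwa [dif_pos j.2]⟩
  · have := congrFun (LinearMap.mem_ker.1 hc) ⟨z, hz⟩
    rw [linForm, Finset.sum_range]
    simp only [Fin.is_lt, dite_true]
    exact this

theorem linForm_sub (w₁ w₂ : ℝ → ℝ) (N : ℕ) (c d : ℕ → ℝ) (t x : ℝ) :
    linForm w₁ w₂ N (fun k => c k - t * d k) x =
      linForm w₁ w₂ N c x - t * linForm w₁ w₂ N d x := by
  simp only [linForm, sub_mul, Finset.sum_sub_distrib, Finset.mul_sum, mul_assoc]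

theorem linForm_truncate (w₁ w₂ : ℝ → ℝ) (N : ℕ) (d : ℕ → ℝ) (x : ℝ) :
    linForm w₁ w₂ (N + 1) (fun k => if k < N then d k else 0) x = linForm w₁ w₂ N d x := by
  rw [linForm, Finset.sum_range_succ]
  simp only [lt_irrefl, if_false, zero_mul, add_zero]
  exact Finset.sum_congr rfl fun k hk => by rw [if_pos (Finset.mem_range.1 hk)]

theorem exists_pos_mul_lt {A B A' B' : ℝ} (hA : 0 < A) (hA' : 0 < A') :
    ∃ t : ℝ, 0 < t ∧ 0 < A - t * B ∧ 0 < A' - t * B' := by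
  have h : ∀ {A : ℝ} (B : ℝ), 0 < A → ∀ᶠ t : ℝ in nhdsWithin 0 (Set.Ioi 0), 0 < A - t * B := by
    intro A B hA
    have : Filter.Tendsto (fun t : ℝ => A - t * B) (nhdsWithin 0 (Set.Ioi 0)) (nhds A) := by
      have h1 : Continuous fun t : ℝ => A - t * B := by fun_prop
      simpa using (h1.tendsto 0).mono_left nhdsWithin_le_nhds
    exact this.eventually (lt_mem_nhds hA)
  obtain ⟨t, h0, h1, h2⟩ :=
    (eventually_mem_nhdsWithin.and ((h B hA).and (h B' hA'))).exists
  exact ⟨t, h0, h1, h2⟩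

/-- In a Chebyshev system, a form with as many inner zeros as possible changes sign at each. -/
theorem exists_linForm_sign (hΔ : Δ.OrdConnected) (hAT : IsATSystem w₁ w₂ Δ) {T : Finset ℝ}
    (hT : ∀ z ∈ T, IsInner Δ z) :
    ∃ c : ℕ → ℝ, ∃ ε : ℝ, (ε = 1 ∨ ε = -1) ∧
      (∀ x ∈ Δ, 0 ≤ ε * linForm w₁ w₂ (T.card + 1) c x * ∏ z ∈ T, (x - z)) ∧
      ∀ x ∈ Δ, linForm w₁ w₂ (T.card + 1) c x = 0 → x ∈ T := by
  obtain ⟨c, hc, hcT⟩ := exists_linForm_eq_zero w₁ w₂ T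
  set F := linForm w₁ w₂ (T.card + 1) c with hF
  have hTΔ : ∀ z ∈ T, z ∈ Δ := fun z hz => (hT z hz).mem hΔ
  have hzero : ∀ x ∈ Δ, F x = 0 → x ∈ T := by
    intro x hx hx0
    by_contra hxT
    have := card_lt_of_linForm_eq_zero hAT hc (T := insert x T) fun z hz => by
      rcases Finset.mem_insert.1 hz with rfl | hz
      · exact ⟨hx, hx0⟩
      · exact ⟨hTΔ z hz, hcT z hz⟩
    rw [Finset.card_insert_of_notMem hxT] at this
    exact lt_irrefl _ this
  have hFcont : ContinuousOn F Δ := continuousOn_linForm hAT _ _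
  obtain ⟨T', hT', ε, hε, hsign⟩ := exists_sign_separator T hΔ hFcont
    fun z hz hz0 => hzero z (hz.mem hΔ) hz0
  refine ⟨c, ε, hε, ?_, hzero⟩
  -- If `F` kept its sign at some `z ∈ T`, a small perturbation would split this zero in two.
  -- Perturbing by a form `G` that vanishes on the rest of `T` but not at `z` preserves the other
  -- zeros, giving one zero too many.
  suffices h : T' = T by rwa [h] at hsign
  by_contra hne
  obtain ⟨z, hzT, hzT'⟩ := Finset.exists_of_ssubset (hT'.ssubset_of_ne hne)
  obtain ⟨d, hd, hdT⟩ := exists_linForm_eq_zero w₁ w₂ (T.erase z)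
  rw [Finset.card_erase_add_one hzT] at hd hdT
  set G := linForm w₁ w₂ T.card d with hG
  have hGz : G z ≠ 0 := by
    intro h0
    refine lt_irrefl _ (card_lt_of_linForm_eq_zero hAT hd (T := T) fun y hy => ⟨hTΔ y hy, ?_⟩)
    by_cases hyz : y = z
    · rw [hyz]; exact h0
    · exact hdT y (Finset.mem_erase.2 ⟨hyz, hy⟩)
  obtain ⟨a, b, haz, hzb, ha, hb, hab⟩ : ∃ a b, a < z ∧ z < b ∧ a ∈ Δ ∧ b ∈ Δ ∧
      ∀ y ∈ T.erase z, y < a ∨ b < y := by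
    obtain ⟨a₀, ha₀, b₀, hb₀, h1, h2⟩ := hT z hzT
    have hev : ∀ᶠ y in nhds z, y ∉ (T.erase z : Finset ℝ) ∧ a₀ < y ∧ y < b₀ :=
      Filter.Eventually.and
        (IsClosed.compl_mem_nhds (T.erase z).finite_toSet.isClosed (by simp))
        ((lt_mem_nhds h1).and (gt_mem_nhds h2))
    obtain ⟨δ, hδ, hball⟩ := Metric.eventually_nhds_iff.1 hev
    have hmem : ∀ y, z - δ / 2 ≤ y → y ≤ z + δ / 2 →
        y ∉ (T.erase z : Finset ℝ) ∧ a₀ < y ∧ y < b₀ := fun y hy1 hy2 => hball (by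
      rw [Real.dist_eq, abs_lt]; constructor <;> linarith)
    refine ⟨z - δ / 2, z + δ / 2, by linarith, by linarith, ?_, ?_, fun y hy => ?_⟩
    · obtain ⟨-, h3, h4⟩ := hmem (z - δ / 2) (by linarith) (by linarith)
      exact hΔ.out ha₀ hb₀ ⟨h3.le, h4.le⟩
    · obtain ⟨-, h3, h4⟩ := hmem (z + δ / 2) (by linarith) (by linarith)
      exact hΔ.out ha₀ hb₀ ⟨h3.le, h4.le⟩
    · by_contra! h3
      exact (hmem y h3.1 h3.2).1 hy
  have hFa : F a ≠ 0 := fun h0 => by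
    rcases hab a (Finset.mem_erase.2 ⟨haz.ne, hzero a ha h0⟩) with h | h <;> linarith
  have hFb : F b ≠ 0 := fun h0 => by
    rcases hab b (Finset.mem_erase.2 ⟨hzb.ne', hzero b hb h0⟩) with h | h <;> linarith
  -- No point of `T'` lies in `[a, b]`, so `F` has the same sign at both ends.
  have hprod : 0 < (∏ y ∈ T', (a - y)) * ∏ y ∈ T', (b - y) := by
    rw [← Finset.prod_mul_distrib]
    refine Finset.prod_pos fun y hy => ?_
    rcases hab y (Finset.mem_erase.2 ⟨fun h => hzT' (h ▸ hy), hT' hy⟩) with h | h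
    · exact mul_pos (by linarith) (by linarith)
    · exact mul_pos_of_neg_of_neg (by linarith) (by linarith)
  have hFab : 0 < F b * F a := by
    have h1 := mul_nonneg (hsign a ha) (hsign b hb)
    have hε2 : ε * ε = 1 := by rcases hε with rfl | rfl <;> norm_num
    have h2 : 0 ≤ (F b * F a) * ((∏ y ∈ T', (a - y)) * ∏ y ∈ T', (b - y)) := by
      calc 0 ≤ _ := h1
        _ = (ε * ε) * ((F b * F a) * ((∏ y ∈ T', (a - y)) * ∏ y ∈ T', (b - y))) := by ring
        _ = _ := by rw [hε2, one_mul]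
    exact lt_of_le_of_ne (nonneg_of_mul_nonneg_left h2 hprod) (mul_ne_zero hFb hFa).symm
  -- The perturbation is `K = F - t F(a) G(z) G`. Its factor makes `K(z) F(a) = -t F(a)² G(z)²`
  -- negative, and a small `t` leaves the signs at `a` and `b` unchanged.
  obtain ⟨t, ht, hta, htb⟩ := exists_pos_mul_lt (B := F a * G z * G a * F a)
    (B' := F a * G z * G b * F a) (mul_self_pos.2 hFa) hFab
  set K := linForm w₁ w₂ (T.card + 1)
    fun k => c k - t * F a * G z * (if k < T.card then d k else 0) with hK
  have hKx : ∀ x, K x = F x - t * F a * G z * G x := fun x => by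
    rw [hK, linForm_sub, linForm_truncate]
  have hKcont : ContinuousOn K Δ := continuousOn_linForm hAT _ _
  have hFz : F z = 0 := hcT z hzT
  have hKz : K z * F a < 0 := by
    have : 0 < t * ((F a * F a) * (G z * G z)) :=
      mul_pos ht (mul_pos (mul_self_pos.2 hFa) (mul_self_pos.2 hGz))
    rw [hKx, hFz]
    linarith
  have hKa : 0 < K a * F a := by rw [hKx]; linarith
  have hKb : 0 < K b * F a := by rw [hKx]; linarith
  have hmul : ∀ {u v : ℝ}, 0 < u * F a → v * F a < 0 → u * v < 0 := by
    intro u v hu hv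
    have h1 : (u * v) * (F a * F a) < 0 := by linarith [mul_neg_of_pos_of_neg hu hv]
    exact neg_of_mul_neg_left h1 (mul_self_nonneg _)
  obtain ⟨y₁, h1, h2, hy₁⟩ := exists_zero_of_mul_neg hΔ hKcont ha (hTΔ z hzT) haz.le
    (hmul hKa hKz)
  obtain ⟨y₂, h3, h4, hy₂⟩ := exists_zero_of_mul_neg hΔ hKcont (hTΔ z hzT) hb hzb.le
    (by rw [mul_comm]; exact hmul hKb hKz)
  have hn1 : y₁ ∉ T.erase z := fun h => by rcases hab y₁ h with h | h <;> linarith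
  have hn2 : y₂ ∉ insert y₁ (T.erase z) := fun h => by
    rcases Finset.mem_insert.1 h with h | h
    · linarith
    · rcases hab y₂ h with h | h <;> linarith
  have hcoef : ∃ j < T.card + 1, c j - t * F a * G z * (if j < T.card then d j else 0) ≠ 0 := by
    by_contra! h0
    have : K z = 0 := Finset.sum_eq_zero fun k hk => by
      dsimp only
      rw [h0 k (Finset.mem_range.1 hk), zero_mul]
    rw [this, zero_mul] at hKz
    exact lt_irrefl _ hKz
  have hcard := card_lt_of_linForm_eq_zero hAT hcoef (T := insert y₂ (insert y₁ (T.erase z)))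
    fun y hy => by
      rw [Finset.mem_insert, Finset.mem_insert] at hy
      rcases hy with rfl | rfl | hy
      · exact ⟨hΔ.out ha hb ⟨by linarith, by linarith⟩, hy₂⟩
      · exact ⟨hΔ.out ha hb ⟨by linarith, by linarith⟩, hy₁⟩
      · refine ⟨hTΔ y (Finset.mem_of_mem_erase hy), ?_⟩
        change K y = 0
        rw [hKx, hdT y hy, show F y = 0 from hcT y (Finset.mem_of_mem_erase hy)]
        ring
  rw [Finset.card_insert_of_notMem hn2, Finset.card_insert_of_notMem hn1,
    Finset.card_erase_add_one hzT] at hcard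
  exact lt_irrefl _ hcard

end AT

/-! ### Positivity at the right end point -/

section Positivity

variable {μ : Measure ℝ} {w₁ w₂ : ℝ → ℝ} {S St : Matrix ℕ ℕ ℝ} {D : ℕ → ℝ} {Δ : Set ℝ}

theorem ae_eq_zero_of_integral_eq_zero_of_sign (hμ : μ Δᶜ = 0) {f : ℝ → ℝ} (hf : Integrable f μ)
    {ε : ℝ} (hε : ε = 1 ∨ ε = -1) (h0 : ∀ x ∈ Δ, 0 ≤ ε * f x) (hint : ∫ x, f x ∂μ = 0) :
    ∀ᵐ x ∂μ, x ∈ Δ ∧ f x = 0 := by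
  have hΔ : ∀ᵐ x ∂μ, x ∈ Δ := hμ
  have h1 : (fun x => ε * f x) =ᵐ[μ] 0 := by
    rw [← integral_eq_zero_iff_of_nonneg_ae (hΔ.mono h0) (hf.const_mul ε), integral_const_mul,
      hint, mul_zero]
  filter_upwards [hΔ, h1] with x hx hx0
  refine ⟨hx, (mul_eq_zero.1 hx0).resolve_left ?_⟩
  rcases hε with rfl | rfl <;> norm_num

theorem eval_prod_X_sub_C (T : Finset ℝ) (x : ℝ) :
    (∏ z ∈ T, (Polynomial.X - Polynomial.C z)).eval x = ∏ z ∈ T, (x - z) := by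
  simp [Polynomial.eval_prod]

theorem typeI_eq_linForm (n : ℕ) (x : ℝ) :
    typeI w₁ w₂ D St n x = linForm w₁ w₂ (n + 1) (fun k => (D n)⁻¹ * St n k) x := by
  simp only [typeI, linForm, Finset.mul_sum, mul_assoc]

/-- Let `p` be monic with simple roots at the sign changes of `Q_n`, so `p Q_n` has constant sign.
Orthogonality excludes fewer than `n` roots; with `n` roots, `∫ p Q_n dμ = 1` fixes the sign as
positive. A zero at 1 would be the forbidden `(n + 1)`-st. -/
theorem typeI_one_pos (hΔ : Δ.OrdConnected) (hΔ1 : IsGreatest Δ 1) (hμ : μ Δᶜ = 0)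
    (hI : ∀ i j, Integrable (fun x => x ^ i * xi w₁ w₂ j x) μ) (hAT : IsATSystem w₁ w₂ Δ)
    (hGB : IsGaussBorel (momentMatrix μ w₁ w₂) S D St) (n : ℕ) :
    0 < typeI w₁ w₂ D St n 1 := by
  have hcoef : ∃ j < n + 1, (D n)⁻¹ * St n j ≠ 0 :=
    ⟨n, n.lt_succ_self, by simp [hGB.lower_right.1, hGB.diag_ne_zero]⟩
  have hcont : ContinuousOn (typeI w₁ w₂ D St n) Δ :=
    (continuousOn_linForm hAT _ _).congr fun x _ => typeI_eq_linForm n x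
  have hfin : {x ∈ Δ | typeI w₁ w₂ D St n x = 0}.Finite := by
    simp_rw [typeI_eq_linForm]
    exact Set.finite_of_encard_le_coe (encard_zeros_linForm_lt hAT hcoef).le
  have hcard : ∀ T : Finset ℝ, (∀ z ∈ T, z ∈ Δ ∧ typeI w₁ w₂ D St n z = 0) → T.card < n + 1 :=
    fun T hT => card_lt_of_linForm_eq_zero hAT hcoef fun z hz => by
      rw [← typeI_eq_linForm]; exact hT z hz
  have hfin' : {x | IsInner Δ x ∧ typeI w₁ w₂ D St n x = 0}.Finite :=
    hfin.subset fun x hx => ⟨hx.1.mem hΔ, hx.2⟩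
  obtain ⟨T, hT, ε, hε, hsign⟩ := exists_sign_separator hfin'.toFinset hΔ hcont
    fun z hz hz0 => by simpa using ⟨hz, hz0⟩
  replace hT : ∀ z ∈ T, IsInner Δ z ∧ typeI w₁ w₂ D St n z = 0 := fun z hz => by
    simpa using hT hz
  have hT1 : ∀ z ∈ T, z < 1 := fun z hz => by
    obtain ⟨-, -, b, hb, -, hzb⟩ := (hT z hz).1
    exact hzb.trans_le (hΔ1.2 hb)
  have hTn : T.card < n + 1 := hcard T fun z hz => ⟨(hT z hz).1.mem hΔ, (hT z hz).2⟩
  set p : Polynomial ℝ := ∏ z ∈ T, (Polynomial.X - Polynomial.C z) with hp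
  have hpm : p.Monic := Polynomial.monic_prod_of_monic _ _ fun z _ => Polynomial.monic_X_sub_C z
  have hpd : p.natDegree = T.card := Polynomial.natDegree_finsetProd_X_sub_C_eq_card T id
  have hpe : ∀ x, p.eval x = ∏ z ∈ T, (x - z) := eval_prod_X_sub_C T
  have hpint : Integrable (fun x => p.eval x * typeI w₁ w₂ D St n x) μ :=
    integrable_eval_mul (integrable_pow_mul_typeI hI · n) p
  have hps : ∀ x ∈ Δ, 0 ≤ ε * (p.eval x * typeI w₁ w₂ D St n x) := fun x hx => by
    have := hsign x hx
    rw [← hpe] at this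
    linarith
  have hval := integral_eval_mul_typeI hGB hI (p := p) (n := n) (by omega)
  have hTeq : T.card = n := by
    by_contra hne
    rw [Polynomial.coeff_eq_zero_of_natDegree_lt (by omega)] at hval
    have h1 := ae_eq_zero_of_integral_eq_zero_of_sign hμ hpint hε hps hval
    -- Roots of `p` are zeros of `Q_n`, so `Q_n = 0` almost everywhere, against `∫ B_n Q_n dμ = 1`.
    have h2 : ∫ x, typeII S n x * typeI w₁ w₂ D St n x ∂μ = 0 := by
      refine integral_eq_zero_of_ae (h1.mono fun x hx => ?_)
      change typeII S n x * typeI w₁ w₂ D St n x = 0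
      rcases mul_eq_zero.1 hx.2 with h | h
      · rw [hpe, Finset.prod_eq_zero_iff] at h
        obtain ⟨z, hz, hxz⟩ := h
        rw [sub_eq_zero.1 hxz, (hT z hz).2, mul_zero]
      · rw [h, mul_zero]
    rw [integral_typeII_mul_typeI hGB hI, if_pos rfl] at h2
    exact one_ne_zero h2
  have hcoeff : p.coeff n = 1 := by rw [← hTeq, ← hpd]; exact hpm
  have hε1 : ε = 1 := by
    refine hε.resolve_right fun h => ?_
    have hΔae : ∀ᵐ x ∂μ, x ∈ Δ := hμ
    have h1 : 0 ≤ ∫ x, ε * (p.eval x * typeI w₁ w₂ D St n x) ∂μ :=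
      integral_nonneg_of_ae (hΔae.mono hps)
    rw [integral_const_mul, hval, hcoeff, h] at h1
    norm_num at h1
  have hp1 : 0 < p.eval 1 := by
    rw [hpe]
    exact Finset.prod_pos fun z hz => by linarith [hT1 z hz]
  have h2 := hps 1 hΔ1.1
  rw [hε1, one_mul] at h2
  refine lt_of_le_of_ne (nonneg_of_mul_nonneg_right h2 hp1) fun h0 => ?_
  have h1T : (1 : ℝ) ∉ T := fun h => lt_irrefl _ (hT1 1 h)
  have := hcard (insert 1 T) fun z hz => by
    rcases Finset.mem_insert.1 hz with rfl | hz
    · exact ⟨hΔ1.1, h0.symm⟩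
    · exact ⟨(hT z hz).1.mem hΔ, (hT z hz).2⟩
  rw [Finset.card_insert_of_notMem h1T, hTeq] at this
  exact lt_irrefl _ this

theorem typeIIPoly_coeff (hS : IsLowerUnitriangular S) (n : ℕ) : (typeIIPoly S n).coeff n = 1 := by
  simp [typeIIPoly, Polynomial.finsetSum_coeff, Polynomial.coeff_X_pow, hS.1]

theorem typeIIPoly_degree_lt (n : ℕ) : (typeIIPoly S n).degree < (n + 1 : ℕ) :=
  degree_sum_C_mul_X_pow_lt (n + 1) (S n)

theorem integral_typeII_mul_linForm (hGB : IsGaussBorel (momentMatrix μ w₁ w₂) S D St)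
    (hI : ∀ i j, Integrable (fun x => x ^ i * xi w₁ w₂ j x) μ) {n N : ℕ} (hN : N ≤ n)
    (c : ℕ → ℝ) :
    Integrable (fun x => typeII S n x * linForm w₁ w₂ N c x) μ ∧
      ∫ x, typeII S n x * linForm w₁ w₂ N c x ∂μ = 0 := by
  have hint : ∀ j, Integrable (fun x => typeII S n x * xi w₁ w₂ j x) μ := fun j =>
    (integrable_eval_mul (hI · j) (typeIIPoly S n)).congr
      (.of_forall fun x => by simp [eval_typeIIPoly])
  have h1 : ∀ x, typeII S n x * linForm w₁ w₂ N c x =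
      ∑ j ∈ Finset.range N, c j * (typeII S n x * xi w₁ w₂ j x) := by
    intro x
    rw [linForm, Finset.mul_sum]
    exact Finset.sum_congr rfl fun k _ => by ring
  simp_rw [h1]
  refine ⟨integrable_finsetSum _ fun j _ => (hint j).const_mul _, ?_⟩
  rw [integral_finsetSum _ fun j _ => (hint j).const_mul _]
  simp_rw [integral_const_mul, integral_typeII_mul_xi hGB hI]
  refine Finset.sum_eq_zero fun j hj => ?_
  rw [lowerInv_eq_zero St ((Finset.mem_range.1 hj).trans_le hN), mul_zero, mul_zero]

/-- With fewer than `n` sign changes, `B_n` would be orthogonal to a form with the same sign changes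
(`exists_linForm_sign`) and so vanish almost everywhere. Hence the monic `B_n` is the product of `n`
factors `x - z` with every `z < 1`. -/
theorem typeII_one_pos (hΔ : Δ.OrdConnected) (hΔ1 : IsGreatest Δ 1) (hμ : μ Δᶜ = 0)
    (hI : ∀ i j, Integrable (fun x => x ^ i * xi w₁ w₂ j x) μ) (hAT : IsATSystem w₁ w₂ Δ)
    (hGB : IsGaussBorel (momentMatrix μ w₁ w₂) S D St) (n : ℕ) :
    0 < typeII S n 1 := by
  set P := typeIIPoly S n with hP
  have hPc : P.coeff n = 1 := typeIIPoly_coeff hGB.lower_left n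
  have hP0 : P ≠ 0 := fun h => by simp [h] at hPc
  have hPe : ∀ x, P.eval x = typeII S n x := eval_typeIIPoly S n
  have hfin : {x | IsInner Δ x ∧ typeII S n x = 0}.Finite :=
    (P.rootSet_finite ℝ).subset fun x hx => by
      rw [Polynomial.mem_rootSet]
      exact ⟨hP0, by simpa [hPe] using hx.2⟩
  have hcont : ContinuousOn (typeII S n) Δ :=
    P.continuous.continuousOn.congr fun x _ => (hPe x).symm
  obtain ⟨T, hT, ε, hε, hsign⟩ := exists_sign_separator hfin.toFinset hΔ hcont
    fun z hz hz0 => by simpa using ⟨hz, hz0⟩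
  replace hT : ∀ z ∈ T, IsInner Δ z ∧ typeII S n z = 0 := fun z hz => by simpa using hT hz
  have hTn : n ≤ T.card := by
    by_contra! hlt
    obtain ⟨c, δ, hδ, hF, hzero⟩ := exists_linForm_sign hΔ hAT fun z hz => (hT z hz).1
    obtain ⟨hint, hint0⟩ := integral_typeII_mul_linForm hGB hI (Nat.succ_le_of_lt hlt) c
    have hs : ∀ x ∈ Δ, 0 ≤ (ε * δ) * (typeII S n x * linForm w₁ w₂ (T.card + 1) c x) := by
      intro x hx
      by_cases hxT : x ∈ T
      · simp [(hT x hxT).2]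
      · have hprod : (∏ z ∈ T, (x - z)) ≠ 0 := Finset.prod_ne_zero_iff.2 fun z hz h =>
          hxT (by rwa [sub_eq_zero.1 h])
        refine nonneg_of_mul_nonneg_left ?_ (mul_self_pos.2 hprod)
        calc 0 ≤ _ := mul_nonneg (hsign x hx) (hF x hx)
          _ = _ := by ring
    have hae := ae_eq_zero_of_integral_eq_zero_of_sign hμ hint
      (by rcases hε with rfl | rfl <;> rcases hδ with rfl | rfl <;> norm_num) hs hint0
    have h2 : ∫ x, typeII S n x * typeI w₁ w₂ D St n x ∂μ = 0 := by
      refine integral_eq_zero_of_ae (hae.mono fun x hx => ?_)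
      have : typeII S n x = 0 := by
        rcases mul_eq_zero.1 hx.2 with h | h
        · exact h
        · exact (hT x (hzero x hx.1 h)).2
      simp [this]
    rw [integral_typeII_mul_typeI hGB hI, if_pos rfl] at h2
    exact one_ne_zero h2
  have hPd : P.natDegree = n := Polynomial.natDegree_eq_of_le_of_coeff_ne_zero
    (Nat.lt_succ_iff.1 ((Polynomial.natDegree_lt_iff_degree_lt hP0).2 (typeIIPoly_degree_lt n))) (by rw [hPc]; exact one_ne_zero)
  have hPm : P.Monic := by rw [Polynomial.Monic, Polynomial.leadingCoeff, hPd, hPc]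
  have hdvd : ∏ z ∈ T, (Polynomial.X - Polynomial.C z) ∣ P := by
    refine Finset.prod_dvd_of_coprime (fun a _ b _ hab => ?_) fun z hz => ?_
    · exact Polynomial.isCoprime_X_sub_C_of_isUnit_sub (sub_ne_zero.2 hab).isUnit
    · rw [Polynomial.dvd_iff_isRoot, Polynomial.IsRoot, hPe]
      exact (hT z hz).2
  have hPeq : ∏ z ∈ T, (Polynomial.X - Polynomial.C z) = P :=
    (Polynomial.eq_of_monic_of_dvd_of_natDegree_le
      (Polynomial.monic_prod_of_monic _ _ fun z _ => Polynomial.monic_X_sub_C z) hPm hdvd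
      (by rw [hPd]; exact hTn.trans (Polynomial.natDegree_finsetProd_X_sub_C_eq_card T id).ge)).symm
  rw [← hPe, ← hPeq, eval_prod_X_sub_C]
  refine Finset.prod_pos fun z hz => ?_
  obtain ⟨-, -, b, hb, -, hzb⟩ := (hT z hz).1
  linarith [hΔ1.2 hb]

/-- The AT property for `A₁ = 1`, `A₂ = 0` allows `w₁` no zero. -/
theorem left_weight_pos (hAT : IsATSystem w₁ w₂ Δ) (hw₁ : ∀ x ∈ Δ, 0 ≤ w₁ x) {x : ℝ}
    (hx : x ∈ Δ) : 0 < w₁ x := by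
  refine lt_of_le_of_ne (hw₁ x hx) fun h0 => ?_
  have := card_lt_of_linForm_eq_zero hAT (N := 1) (c := fun _ => 1) ⟨0, by simp⟩ (T := {x})
    fun z hz => by
      rw [Finset.mem_singleton] at hz
      subst hz
      exact ⟨hx, by simp [linForm, xi, ← h0]⟩
  simp at this

end Positivity

/-! ### Sums of moments -/

/-- Fatou's lemma for the nonnegative even terms, which tend to infinity where `|x| > 1`. This
matters because `Δ` may extend to the left of `-1`. -/
theorem ae_abs_le_one_of_moments_bounded {μ : Measure ℝ} {f : ℝ → ℝ} (hf : ∀ᵐ x ∂μ, 0 < f x)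
    (hint : ∀ n : ℕ, Integrable (fun x => x ^ n * f x) μ)
    (h1 : ∀ n : ℕ, ∫ x, x ^ n * f x ∂μ ≤ 1) : ∀ᵐ x ∂μ, |x| ≤ 1 := by
  set F : ℕ → ℝ → ℝ≥0∞ := fun N x => ENNReal.ofReal (x ^ (2 * N) * f x) with hF
  have hmeas : ∀ N, AEMeasurable (F N) μ := fun N => (hint (2 * N)).aemeasurable.ennreal_ofReal
  have hle : ∀ N, ∫⁻ x, F N x ∂μ ≤ 1 := fun N => by
    rw [← ofReal_integral_eq_lintegral_ofReal (hint (2 * N))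
      (hf.mono fun x hx => mul_nonneg ((even_two_mul N).pow_nonneg x) hx.le),
      ← ENNReal.ofReal_one]
    exact ENNReal.ofReal_le_ofReal (h1 _)
  have hlim : ∫⁻ x, Filter.liminf (fun N => F N x) Filter.atTop ∂μ ≤ 1 :=
    (lintegral_liminf_le' hmeas).trans
      ((Filter.liminf_le_liminf (.of_forall hle)).trans (by simp))
  have hlmeas : AEMeasurable (fun x => Filter.liminf (fun N => F N x) Filter.atTop) μ := by
    simp_rw [Filter.liminf_eq_iSup_iInf_of_nat]
    exact .iSup fun n => .biInf _ (Set.to_countable _) fun i _ => hmeas i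
  have hfin := ae_lt_top' hlmeas (hlim.trans_lt ENNReal.one_lt_top).ne
  filter_upwards [hf, hfin] with x hx hx'
  by_contra! hcon
  have htend : Filter.Tendsto (fun N => F N x) Filter.atTop (nhds ⊤) := by
    refine ENNReal.tendsto_ofReal_nhds_top.2 ?_
    refine Filter.Tendsto.atTop_mul_const hx ?_
    have h2 : (1 : ℝ) < x ^ 2 := by rw [← sq_abs]; nlinarith
    simp_rw [pow_mul]
    exact tendsto_pow_atTop_atTop_of_one_lt h2
  rw [htend.liminf_eq] at hx'
  exact lt_irrefl _ hx'

theorem tsum_ofReal_pow_mul {x w : ℝ} (hx : |x| < 1) (hw : 0 < w) :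
    ∑' N : ℕ, ENNReal.ofReal (x ^ (2 * N) * (1 + x) * w) =
      ENNReal.ofReal w / ENNReal.ofReal (1 - x) := by
  obtain ⟨h1, h2⟩ := abs_lt.1 hx
  have hx2 : x ^ 2 < 1 := by rw [sq_lt_one_iff_abs_lt_one]; exact hx
  have hs : HasSum (fun N : ℕ => x ^ (2 * N) * (1 + x) * w) (w / (1 - x)) := by
    have h3 := (hasSum_geometric_of_lt_one (sq_nonneg x) hx2).mul_right ((1 + x) * w)
    have h4 : (1 - x ^ 2)⁻¹ * ((1 + x) * w) = w / (1 - x) := by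
      have h5 : 1 - x ≠ 0 := by linarith
      have h6 : 1 + x ≠ 0 := by linarith
      rw [show 1 - x ^ 2 = (1 - x) * (1 + x) by ring]
      field_simp
    rw [h4] at h3
    simpa only [pow_mul, mul_assoc] using h3
  rw [← ENNReal.ofReal_tsum_of_nonneg _ hs.summable, hs.tsum_eq,
    ENNReal.ofReal_div_of_pos (by linarith)]
  exact fun N => mul_nonneg (mul_nonneg ((even_two_mul N).pow_nonneg x) (by linarith)) hw.le

/-- Odd powers are negative for `x < 0`, so Tonelli is applied to the pairs `x^(2N) + x^(2N+1) =
x^(2N) (1 + x)`, nonnegative on `[-1, 1]`. -/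
theorem tsum_moments_eq_top_iff {μ : Measure ℝ} {f : ℝ → ℝ}
    (hf : ∀ᵐ x ∂μ, x ≤ 1 ∧ 0 < f x) (hint : ∀ n : ℕ, Integrable (fun x => x ^ n * f x) μ)
    (h0 : ∀ n : ℕ, 0 ≤ ∫ x, x ^ n * f x ∂μ) (h1 : ∀ n : ℕ, ∫ x, x ^ n * f x ∂μ ≤ 1) :
    ∑' n : ℕ, ENNReal.ofReal (∫ x, x ^ n * f x ∂μ) = ⊤ ↔
      ∫⁻ x, ENNReal.ofReal (f x) / ENNReal.ofReal (1 - x) ∂μ = ⊤ := by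
  have habs := ae_abs_le_one_of_moments_bounded (hf.mono fun _ h => h.2) hint h1
  have hf0 : Integrable f μ := by simpa using hint 0
  set u : ℕ → ℝ → ℝ≥0∞ := fun N x => ENNReal.ofReal (x ^ (2 * N) * (1 + x) * f x) with hu
  have hsplit : ∀ N : ℕ, (fun x => x ^ (2 * N) * (1 + x) * f x) =
      fun x => x ^ (2 * N) * f x + x ^ (2 * N + 1) * f x := fun N => by
    funext x; ring
  have hui : ∀ N : ℕ, Integrable (fun x => x ^ (2 * N) * (1 + x) * f x) μ := fun N => by
    rw [hsplit]; exact (hint _).add (hint _)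
  have hsum : ∑' n : ℕ, ENNReal.ofReal (∫ x, x ^ n * f x ∂μ) = ∫⁻ x, ∑' N, u N x ∂μ := by
    rw [lintegral_tsum fun N => (hui N).aemeasurable.ennreal_ofReal,
      ← tsum_even_add_odd ENNReal.summable ENNReal.summable, ← ENNReal.tsum_add]
    refine tsum_congr fun N => ?_
    rw [← ofReal_integral_eq_lintegral_ofReal (hui N), hsplit,
      integral_add (hint _) (hint _), ENNReal.ofReal_add (h0 _) (h0 _)]
    filter_upwards [hf, habs] with x hx hx'
    exact mul_nonneg (mul_nonneg ((even_two_mul N).pow_nonneg x)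
      (by linarith [(abs_le.1 hx').1])) hx.2.le
  -- The paired sum equals the quotient except at `x = -1`, where it is 0 instead of `f / 2`; the
  -- integrable summand `f` absorbs this.
  have hpt : ∀ᵐ x ∂μ, (∑' N, u N x ≤ ENNReal.ofReal (f x) / ENNReal.ofReal (1 - x)) ∧
      ENNReal.ofReal (f x) / ENNReal.ofReal (1 - x) ≤ ∑' N, u N x + ENNReal.ofReal (f x) := by
    filter_upwards [hf, habs] with x hx hx'
    rcases hx'.lt_or_eq with hlt | heq
    · rw [← tsum_ofReal_pow_mul hlt hx.2]
      exact ⟨le_rfl, le_self_add⟩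
    · rcases eq_or_eq_neg_of_abs_eq heq with rfl | rfl
      · have h2 : ∑' N, u N 1 = ⊤ := by
          simp only [hu, one_pow, one_mul]
          refine ENNReal.tsum_const_eq_top_of_ne_zero ?_
          exact (ENNReal.ofReal_pos.2 (by linarith [hx.2])).ne'
        have h3 : ENNReal.ofReal (f 1) / ENNReal.ofReal (1 - 1) = ⊤ := by
          rw [sub_self, ENNReal.ofReal_zero]
          exact ENNReal.div_zero (ENNReal.ofReal_pos.2 hx.2).ne'
        rw [h2, h3]
        simp
      · refine ⟨by simp [hu], le_add_left ?_⟩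
        refine ENNReal.div_le_of_le_mul (le_mul_of_one_le_right' ?_)
        rw [← ENNReal.ofReal_one]
        exact ENNReal.ofReal_le_ofReal (by norm_num)
  rw [hsum]
  constructor
  · intro h
    rw [← top_le_iff, ← h]
    exact lintegral_mono_ae (hpt.mono fun _ h => h.1)
  · intro h
    have h2 := lintegral_mono_ae (hpt.mono fun _ h => h.2)
    rw [h, lintegral_add_right' _ hf0.aemeasurable.ennreal_ofReal, top_le_iff,
      ENNReal.add_eq_top] at h2
    exact h2.resolve_right hf0.lintegral_lt_top.ne

end

end MOP

/-! ### The integral criterion, read off at state 0 -/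

theorem mainTheorem3
    (Δ : Set ℝ) (hΔ : Δ.OrdConnected) (hΔ1 : IsGreatest Δ 1)
    (μ : MeasureTheory.Measure ℝ) (hμ : μ Δᶜ = 0)
    (w₁ w₂ : ℝ → ℝ) (hw₁ : ∀ x ∈ Δ, 0 ≤ w₁ x)
    (hmom₁ : ∀ k : ℕ, MeasureTheory.Integrable (fun x => x ^ k * w₁ x) μ)
    (hmom₂ : ∀ k : ℕ, MeasureTheory.Integrable (fun x => x ^ k * w₂ x) μ)
    (hAT : MOP.IsATSystem w₁ w₂ Δ)
    (S St : Matrix ℕ ℕ ℝ) (D : ℕ → ℝ)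
    (hGB : MOP.IsGaussBorel (MOP.momentMatrix μ w₁ w₂) S D St)
    (hH : ∀ n m, 0 ≤ MOP.hessenberg S n m)
    (ha : ∀ n, 0 < MOP.hessenberg S (n + 2) n) :
    MOP.IsStochastic (MOP.hatH S) ∧ MOP.IsStochastic (MOP.checkH w₁ w₂ S D St) ∧
    ((MOP.hatH S).IsIrreducible → (MOP.checkH w₁ w₂ S D St).IsIrreducible →
      ((MOP.IsRecurrent (MOP.hatH S) ↔
          ∫⁻ x in Δ, ENNReal.ofReal (w₁ x) / ENNReal.ofReal (1 - x) ∂μ = ⊤) ∧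
        (MOP.IsRecurrent (MOP.checkH w₁ w₂ S D St) ↔
          ∫⁻ x in Δ, ENNReal.ofReal (w₁ x) / ENNReal.ofReal (1 - x) ∂μ = ⊤)) ∧
      (∫⁻ x in Δ, ENNReal.ofReal (w₁ x) / ENNReal.ofReal (1 - x) ∂μ < ⊤ →
        MOP.IsTransient (MOP.hatH S) ∧ MOP.IsTransient (MOP.checkH w₁ w₂ S D St))) := by
  have hI := MOP.integrable_pow_mul_xi hmom₁ hmom₂
  have hB : ∀ n, 0 < MOP.typeII S n 1 := MOP.typeII_one_pos hΔ hΔ1 hμ hI hAT hGB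
  have hQ : ∀ n, 0 < MOP.typeI w₁ w₂ D St n 1 := MOP.typeI_one_pos hΔ hΔ1 hμ hI hAT hGB
  have hst := MOP.hatH_isStochastic hGB.lower_left hH hB
  have hst' := MOP.checkH_isStochastic hGB hI hH hQ
  refine ⟨hst, hst', fun hirr hirr' => ?_⟩
  have hae : ∀ᵐ x ∂μ, x ∈ Δ := hμ
  have hw₁pos : ∀ x ∈ Δ, 0 < w₁ x := fun x hx => MOP.left_weight_pos hAT hw₁ hx
  have hQ0 : ∀ x, MOP.typeII S 0 x * MOP.typeI w₁ w₂ D St 0 x = (D 0)⁻¹ * w₁ x := fun x => by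
    simp [MOP.typeII, MOP.typeI, MOP.xi, hGB.lower_left.1, hGB.lower_right.1]
  -- The sign of `D₀` comes from `B₀(1) Q₀(1) = w₁(1) / D₀`.
  have hD0 : 0 < (D 0)⁻¹ := by
    have h1 := mul_pos (hB 0) (hQ 0)
    rw [hQ0] at h1
    exact pos_of_mul_pos_left h1 (hw₁pos 1 hΔ1.1).le
  have hmm : ∀ n, MOP.mixedMoment μ w₁ w₂ S D St n 0 0 =
      ∫ x, x ^ n * ((D 0)⁻¹ * w₁ x) ∂μ := fun n => by
    simp only [MOP.mixedMoment, hQ0]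
  have hstep : ∀ n, MOP.stepProb (MOP.hatH S) 0 n 0 =
      ENNReal.ofReal (∫ x, x ^ n * ((D 0)⁻¹ * w₁ x) ∂μ) := fun n => by
    rw [MOP.stepProb_hatH hGB hI hH hB, hmm, mul_comm, mul_inv_cancel_left₀ (hB 0).ne']
  have hstep' : ∀ n, MOP.stepProb (MOP.checkH w₁ w₂ S D St) 0 n 0 =
      ENNReal.ofReal (∫ x, x ^ n * ((D 0)⁻¹ * w₁ x) ∂μ) := fun n => by
    rw [MOP.stepProb_checkH hGB hI hH hQ, hmm, mul_comm, mul_inv_cancel_left₀ (hQ 0).ne']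
  have hsum := MOP.tsum_moments_eq_top_iff (μ := μ) (f := fun x => (D 0)⁻¹ * w₁ x)
    (hae.mono fun x hx => ⟨hΔ1.2 hx, mul_pos hD0 (hw₁pos x hx)⟩)
    (fun n => ((hmom₁ n).const_mul (D 0)⁻¹).congr (.of_forall fun x => by ring))
    (fun n => hmm n ▸ MOP.mixedMoment_nonneg hGB hI hH n 0 0)
    -- The moments are at most one because they are return probabilities.
    (fun n => by
      rw [← ENNReal.ofReal_le_one, ← hstep]
      exact MOP.stepProb_le_one hst 0 n 0)
  have hint : ∫⁻ x, ENNReal.ofReal ((D 0)⁻¹ * w₁ x) / ENNReal.ofReal (1 - x) ∂μ = ⊤ ↔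
      ∫⁻ x in Δ, ENNReal.ofReal (w₁ x) / ENNReal.ofReal (1 - x) ∂μ = ⊤ := by
    rw [MeasureTheory.Measure.restrict_eq_self_of_ae_mem hae]
    simp_rw [ENNReal.ofReal_mul hD0.le, mul_div_assoc]
    rw [MeasureTheory.lintegral_const_mul' _ _ ENNReal.ofReal_ne_top]
    constructor
    · intro h
      exact (ENNReal.mul_eq_top.1 h).elim And.right fun h => absurd h.1 ENNReal.ofReal_ne_top
    · intro h
      rw [h, ENNReal.mul_top (ENNReal.ofReal_pos.2 hD0).ne']
  have hG := MOP.isRecurrent_iff hst hirr 0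
  have hG' := MOP.isRecurrent_iff hst' hirr' 0
  simp_rw [hstep] at hG
  simp_rw [hstep'] at hG'
  refine ⟨⟨hG.trans (hsum.trans hint), hG'.trans (hsum.trans hint)⟩, fun hlt => ?_⟩
  refine ⟨MOP.isTransient_of_ne_top hst hirr 0 ?_, MOP.isTransient_of_ne_top hst' hirr' 0 ?_⟩
  · simp_rw [hstep]
    exact fun h => hlt.ne ((hsum.trans hint).1 h)
  · simp_rw [hstep']
    exact fun h => hlt.ne ((hsum.trans hint).1 h)
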